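/- Let $X_1,X_2,\dots$ be i.i.d. random vectors in $\mathbb R^2$ with probability density $f$, and let $\phi(t)=\int_{\mathbb R^2}e^{it'x}f(x)\,dx$. For $n\ge 2$ let $\mathcal C_n(t)=n^{-1}\sum_{j=1}^n e^{it'X_j}$ be the empirical characteristic function, let $A_n\subseteq\mathbb R^2$ be the (measurable, possibly data-dependent) set of acceptable frequencies, and put $$\hat\kappa_n(t)=\frac{n}{2(n-1)}\left[1+\sqrt{1-\frac{4(n-1)}{|n\,\mathcal C_n(t)|^2}}\,\right]I_{A_n}(t),\qquad \hat K_n(x)=\frac1{(2\pi)^2}\int_{\mathbb R^2}e^{-it'x}\hat\kappa_n(t)\,dt,\qquad \hat f_n(x)=\frac1n\sum_{j=1}^n\hat K_n(x-X_j),$$ where the square root of a negative number is read as $0$ (this plays no role if $A_n$ contains only frequencies with $|n\,\mathcal C_n(t)|^2\ge 4(n-1)$). Let $\mathcal V$ denote Lebesgue measure on $\mathbb R^2$. Assume that $f$ is square integrable, that $\phi$ is integrable, and that there are non-random measurable sets $D_n$ (with $D_n=A_n$ if the $A_n$ are themselves non-random) such that almost surely $A_n\subseteq D_n$ for all large $n$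 and $$\mathcal V(A_n)\to\infty\ \text{ a.s.},\qquad \mathcal V(D_n)/\sqrt n\to0,\qquad \mathcal V\big(\{t\notin A_n:\ |t|<R\}\big)\to0\ \text{ for every } R>0,\ \text{a.s.},\qquad n\to\infty .$$ Then: 1. There is a Lebesgue-null set $N\subset\mathbb R^2$ such that, almost surely, $\hat f_n(x)\to f(x)$ for every $x\notin N$. 2. Let $\chi$ be the support of $f$, that is, the set of points all of whose neighbourhoods have positive probability under $f$. If $f$ is continuous on $\chi$, then almost surely $\hat f_n\to f$ uniformly on $\chi$; if moreover $f=0$ outside $\chi$ (in particular if $f$ is continuous on $\mathbb R^2$), then almost surely $\hat f_n\to f$ uniformly on $\mathbb R^2$. -/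

import Mathlib

open MeasureTheory ProbabilityTheory Filter Topology
open scoped ENNReal RealInnerProductSpace

noncomputable section

/-- The Euclidean plane, used both as data space and as frequency space. -/
abbrev Plane : Type := EuclideanSpace ℝ (Fin 2)

/-- The (absolutely continuous) law on the plane with density `f`. -/
def densityLaw (f : Plane → ℝ) : Measure Plane :=
  volume.withDensity (fun x => ENNReal.ofReal (f x))

/-- The support of a density: the topological support of its law, that is, the points all of whose
neighbourhoods have positive mass. -/
def densitySupport (f : Plane → ℝ) : Set Plane := (densityLaw f).support

/-- The Fourier transform `φ(t) = ∫ exp(i t'x) f(x) dx` of a density (its characteristic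
function). -/
def densityFourier (f : Plane → ℝ) (t : Plane) : ℂ :=
  ∫ x : Plane, Complex.exp (Complex.I * (⟪t, x⟫ : ℝ)) * (f x : ℂ)

/-- The empirical characteristic function `n⁻¹ ∑ⱼ exp(i t'Xⱼ)` of the first `n` data points. -/
def ecf (X : ℕ → Plane) (n : ℕ) (t : Plane) : ℂ :=
  (n : ℂ)⁻¹ * ∑ j ∈ Finset.range n, Complex.exp (Complex.I * (⟪t, X j⟫ : ℝ))

open Classical in
/-- The optimal transform kernel
`n / (2(n-1)) * [1 + √(1 - 4(n-1) / |n C(t)|²)] * I_A(t)`.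
`Real.sqrt` is `0` on negative numbers, so that on the part of `A` where
`|n C(t)|² < 4(n-1)` (if there is any) the square root is read as `0`. -/
def sceTransformKernel (X : ℕ → Plane) (A : Set Plane) (n : ℕ) (t : Plane) : ℝ :=
  if t ∈ A then
    (n : ℝ) / (2 * ((n : ℝ) - 1)) *
      (1 + Real.sqrt (1 - 4 * ((n : ℝ) - 1) / ‖(n : ℂ) * ecf X n t‖ ^ 2))
  else 0

/-- The optimal kernel: the transform kernel taken back to the data space,
`K(x) = (2π)⁻² ∫ exp(-i t'x) κ(t) dt`. -/
def sceKernel (X : ℕ → Plane) (A : Set Plane) (n : ℕ) (x : Plane) : ℂ :=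
  ((2 * Real.pi : ℝ) : ℂ)⁻¹ ^ 2 *
    ∫ t : Plane, Complex.exp (-Complex.I * (⟪t, x⟫ : ℝ)) * (sceTransformKernel X A n t : ℂ)

/-- The self-consistent estimator `n⁻¹ ∑ⱼ K(x - Xⱼ)` from the first `n` data points, with set of
acceptable frequencies `A`. It is real whenever `A = -A`. -/
def sce (X : ℕ → Plane) (A : Set Plane) (n : ℕ) (x : Plane) : ℂ :=
  (n : ℂ)⁻¹ * ∑ j ∈ Finset.range n, sceKernel X A n (x - X j)

end

/-! The estimator is the inverse Fourier transform of `κ · ecf`, with `κ` the transform kernel, and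
`f` agrees almost everywhere with the continuous function `fourierInversion f`. So it is enough to
bound the `L¹` distance between `κ · ecf` and `φ`, which controls the error uniformly in `x`
(`norm_sce_sub_fourierInversion_le`). That distance splits into three parts. Off `A n` only `∫ |φ|`
remains, and it vanishes because `φ` is integrable and `A n` fills every ball in measure. On `A n`,
`|κ - 1| |ecf|` is `O(n^(-1/2))` however small `ecf` is, and this is beaten by `V(D n) = o(√n)`.

The remaining part, `∫_{D n} |ecf - φ|`, carries the difficulty. By Cauchy-Schwarz it is at most `√V
/ n` times the norm of a sum of `n` i.i.d. centred vectors in `L²(D n)`, each of norm at most `2√V`.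
Its mean tends to zero, but almost sure convergence needs summable tails. A bound using only the
norms decays like `exp(-c n / V²)`, where `n / V²` may grow arbitrarily slowly. The gain comes from
the weak variance: the covariance has kernel `φ(t - s)`, so the Schur test bounds it by `∫ |φ|`,
independently of `V` (`integral_norm_charIntegral_sq_le`). A Bernstein-type inequality in Hilbert
space (`measure_norm_sum_ge_le`) then gives `exp(-c n / V) ≤ exp(-c √n)`, and Borel-Cantelli
concludes. The window `D n` must be non-random because this inequality is applied in the fixed space
`L²(D n)`. -/

/-! ### Bernstein-type concentration in Hilbert space through a smoothed norm -/

section HilbertConcentration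

variable {H : Type*} [NormedAddCommGroup H] [InnerProductSpace ℂ H]

/-- The concave square root lies below its tangent at `B + ‖s‖²`. The smoothing `B` keeps the
second-order term bounded near `s = 0`. -/
lemma sqrt_add_norm_add_sq_le {B : ℝ} (hB : 0 < B) (s z : H) :
    Real.sqrt (B + ‖s + z‖ ^ 2) ≤ Real.sqrt (B + ‖s‖ ^ 2) +
      (inner ℂ s z).re / Real.sqrt (B + ‖s‖ ^ 2) + ‖z‖ ^ 2 / (2 * Real.sqrt B) := by
  set a := Real.sqrt (B + ‖s‖ ^ 2) with ha
  have hapos : 0 < a := Real.sqrt_pos.2 (by positivity)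
  have ha2 : a ^ 2 = B + ‖s‖ ^ 2 := Real.sq_sqrt (by positivity)
  have hBa : Real.sqrt B ≤ a := Real.sqrt_le_sqrt (by nlinarith [sq_nonneg ‖s‖])
  have hBpos : 0 < Real.sqrt B := Real.sqrt_pos.2 hB
  have hns : ‖s + z‖ ^ 2 = ‖s‖ ^ 2 + 2 * (inner ℂ s z).re + ‖z‖ ^ 2 := by
    simpa using norm_add_sq (𝕜 := ℂ) s z
  have h1 : Real.sqrt (B + ‖s + z‖ ^ 2) ≤
      a + (2 * (inner ℂ s z).re + ‖z‖ ^ 2) / (2 * a) := by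
    have hq := Real.sq_sqrt (show 0 ≤ B + ‖s + z‖ ^ 2 by positivity)
    set q := Real.sqrt (B + ‖s + z‖ ^ 2)
    have : q ^ 2 = a ^ 2 + (2 * (inner ℂ s z).re + ‖z‖ ^ 2) := by rw [hq, hns, ha2]; ring
    have h2 : 2 * (inner ℂ s z).re + ‖z‖ ^ 2 = q ^ 2 - a ^ 2 := by linarith
    rw [h2, ← sub_nonneg]
    have : a + (q ^ 2 - a ^ 2) / (2 * a) - q = (a - q) ^ 2 / (2 * a) := by field_simp; ring
    rw [this]; positivity
  have h2 : ‖z‖ ^ 2 / (2 * a) ≤ ‖z‖ ^ 2 / (2 * Real.sqrt B) := by gcongr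
  have h3 : (2 * (inner ℂ s z).re + ‖z‖ ^ 2) / (2 * a) =
      (inner ℂ s z).re / a + ‖z‖ ^ 2 / (2 * a) := by field_simp
  linarith

variable [MeasurableSpace H] [BorelSpace H]

/-- Only the component of `z` along `s` enters at first order. It is centred, and `exp y ≤ 1 + y +
y²` for `|y| ≤ 1` brings in its variance, which is at most `l² v` as `‖s‖ ≤ a`. The crude bound `‖z‖
≤ L` is spent only on the second-order term, damped by `√B`. -/
lemma lintegral_exp_sqrt_add_le (ν : Measure H) [IsProbabilityMeasure ν] {L v : ℝ}
    (hL : ∀ᵐ z ∂ν, ‖z‖ ≤ L) (hmean : ∀ h : H, ∫ z, (inner ℂ h z).re ∂ν = 0)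
    (hvar : ∀ h : H, ∫ z, (inner ℂ h z).re ^ 2 ∂ν ≤ v * ‖h‖ ^ 2)
    {l B : ℝ} (hl : 0 ≤ l) (hlL : l * L ≤ 1) (hB : 0 < B) (hv : 0 ≤ v) (s : H) :
    ∫⁻ z, ENNReal.ofReal (Real.exp (l * Real.sqrt (B + ‖s + z‖ ^ 2))) ∂ν ≤
      ENNReal.ofReal (Real.exp (l * Real.sqrt (B + ‖s‖ ^ 2))) *
        ENNReal.ofReal (Real.exp (l ^ 2 * v + l * L ^ 2 / (2 * Real.sqrt B))) := by
  set a := Real.sqrt (B + ‖s‖ ^ 2) with ha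
  have hapos : 0 < a := Real.sqrt_pos.2 (by positivity)
  have ha2 : a ^ 2 = B + ‖s‖ ^ 2 := Real.sq_sqrt (by positivity)
  have hsa : ‖s‖ ≤ a := Real.le_sqrt_of_sq_le (by linarith)
  have hBpos : 0 < Real.sqrt B := Real.sqrt_pos.2 hB
  set y : H → ℝ := fun z => l * (inner ℂ s z).re / a with hy
  have hymeas : Measurable y := by
    have : Continuous y := by
      simp only [hy]
      exact ((continuous_const.mul (Complex.continuous_re.comp
        (continuous_const.inner continuous_id))).div_const _)
    exact this.measurable
  have hybd : ∀ᵐ z ∂ν, |y z| ≤ 1 := by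
    filter_upwards [hL] with z hz
    have h1 : |(inner ℂ s z).re| ≤ a * L :=
      (Complex.abs_re_le_norm _).trans ((norm_inner_le_norm s z).trans
        (mul_le_mul hsa hz (norm_nonneg _) hapos.le))
    simp only [hy]
    rw [abs_div, abs_mul, abs_of_nonneg hl, abs_of_pos hapos, div_le_one hapos]
    calc l * |(inner ℂ s z).re| ≤ l * (a * L) := by gcongr
      _ = a * (l * L) := by ring
      _ ≤ a * 1 := by gcongr
      _ = a := mul_one a
  have hyint : Integrable y ν :=
    Integrable.of_bound hymeas.aestronglyMeasurable 1 (by simpa using hybd)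
  have hy2int : Integrable (fun z => y z ^ 2) ν :=
    Integrable.of_bound (hymeas.pow_const 2).aestronglyMeasurable 1 (by
      filter_upwards [hybd] with z hz
      rw [Real.norm_eq_abs, abs_pow]
      exact pow_le_one₀ (abs_nonneg _) hz)
  have hint : ∫ z, (1 + y z + y z ^ 2) ∂ν ≤ Real.exp (l ^ 2 * v) := by
    rw [integral_add (by fun_prop) hy2int, integral_add (by fun_prop) hyint]
    have e1 : ∫ z, y z ∂ν = 0 := by
      simp only [hy, mul_div_assoc]
      rw [integral_const_mul, integral_div, hmean]; simp
    have e2 : ∫ z, y z ^ 2 ∂ν ≤ l ^ 2 * v := by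
      have : ∀ z, y z ^ 2 = (l / a) ^ 2 * (inner ℂ s z).re ^ 2 := fun z => by
        simp only [hy]; ring
      simp only [this]
      rw [integral_const_mul]
      calc (l / a) ^ 2 * ∫ z, (inner ℂ s z).re ^ 2 ∂ν
          ≤ (l / a) ^ 2 * (v * ‖s‖ ^ 2) := by gcongr; exact hvar s
        _ ≤ (l / a) ^ 2 * (v * a ^ 2) := by gcongr
        _ = l ^ 2 * v := by field_simp
    rw [e1]
    simp only [integral_const, probReal_univ, smul_eq_mul, mul_one]
    linarith [Real.add_one_le_exp (l ^ 2 * v)]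
  have hpt : ∀ᵐ z ∂ν, ENNReal.ofReal (Real.exp (l * Real.sqrt (B + ‖s + z‖ ^ 2))) ≤
      ENNReal.ofReal (Real.exp (l * a) * Real.exp (l * L ^ 2 / (2 * Real.sqrt B))) *
        ENNReal.ofReal (1 + y z + y z ^ 2) := by
    filter_upwards [hL, hybd] with z hz hyz
    rw [← ENNReal.ofReal_mul (by positivity)]
    apply ENNReal.ofReal_le_ofReal
    have h1 := sqrt_add_norm_add_sq_le hB s z
    have h2 : ‖z‖ ^ 2 / (2 * Real.sqrt B) ≤ L ^ 2 / (2 * Real.sqrt B) := by gcongr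
    have h3 : l * Real.sqrt (B + ‖s + z‖ ^ 2) ≤ l * a + l * L ^ 2 / (2 * Real.sqrt B) + y z := by
      calc l * Real.sqrt (B + ‖s + z‖ ^ 2)
          ≤ l * (a + (inner ℂ s z).re / a + L ^ 2 / (2 * Real.sqrt B)) := by
            gcongr; linarith
        _ = _ := by simp only [hy]; ring
    have h4 : Real.exp (y z) ≤ 1 + y z + y z ^ 2 := by
      linarith [(abs_le.1 (Real.abs_exp_sub_one_sub_id_le hyz)).2]
    calc Real.exp (l * Real.sqrt (B + ‖s + z‖ ^ 2))
        ≤ Real.exp (l * a + l * L ^ 2 / (2 * Real.sqrt B) + y z) := Real.exp_le_exp.2 h3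
      _ = Real.exp (l * a) * Real.exp (l * L ^ 2 / (2 * Real.sqrt B)) * Real.exp (y z) := by
        rw [Real.exp_add, Real.exp_add]
      _ ≤ _ := by gcongr
  calc _ ≤ ∫⁻ z, ENNReal.ofReal (Real.exp (l * a) * Real.exp (l * L ^ 2 / (2 * Real.sqrt B))) *
        ENNReal.ofReal (1 + y z + y z ^ 2) ∂ν := lintegral_mono_ae hpt
    _ = ENNReal.ofReal (Real.exp (l * a) * Real.exp (l * L ^ 2 / (2 * Real.sqrt B))) *
        ENNReal.ofReal (∫ z, (1 + y z + y z ^ 2) ∂ν) := by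
      rw [lintegral_const_mul _ (by fun_prop), ofReal_integral_eq_lintegral_ofReal]
      · fun_prop
      · exact Eventually.of_forall fun z => by
          simp only [Pi.zero_apply]; nlinarith [sq_nonneg (y z + 1 / 2)]
    _ ≤ ENNReal.ofReal (Real.exp (l * a) * Real.exp (l * L ^ 2 / (2 * Real.sqrt B))) *
        ENNReal.ofReal (Real.exp (l ^ 2 * v)) := by gcongr
    _ = _ := by
      rw [← ENNReal.ofReal_mul (by positivity), ← ENNReal.ofReal_mul (by positivity), Real.exp_add]
      congr 1; ring

variable [SecondCountableTopology H] {Ω : Type*} [MeasurableSpace Ω] {P : Measure Ω} [IsProbabilityMeasure P]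

/-- The one-step bound is uniform in `s`, so conditioning on the partial sum, which is independent
of the next term, multiplies in one factor per step. -/
lemma lintegral_exp_sqrt_sum_le {Z : ℕ → Ω → H} (hZ : ∀ j, Measurable (Z j)) (hind : iIndepFun Z P)
    (ν : Measure H) [IsProbabilityMeasure ν] (hlaw : ∀ j, P.map (Z j) = ν) {L v : ℝ}
    (hL : ∀ᵐ z ∂ν, ‖z‖ ≤ L) (hmean : ∀ h : H, ∫ z, (inner ℂ h z).re ∂ν = 0)
    (hvar : ∀ h : H, ∫ z, (inner ℂ h z).re ^ 2 ∂ν ≤ v * ‖h‖ ^ 2)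
    {l B : ℝ} (hl : 0 ≤ l) (hlL : l * L ≤ 1) (hB : 0 < B) (hv : 0 ≤ v) (n : ℕ) :
    ∫⁻ ω, ENNReal.ofReal (Real.exp (l * Real.sqrt (B + ‖∑ j ∈ Finset.range n, Z j ω‖ ^ 2))) ∂P ≤
      ENNReal.ofReal (Real.exp (l * Real.sqrt B +
        n * (l ^ 2 * v + l * L ^ 2 / (2 * Real.sqrt B)))) := by
  induction n with
  | zero => simp
  | succ k ih =>
    set S : Ω → H := fun ω => ∑ j ∈ Finset.range k, Z j ω with hS
    have hSm : Measurable S := Finset.measurable_fun_sum _ fun j _ => hZ j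
    have hSZ : IndepFun S (Z k) P := by
      have := hind.indepFun_finsetSum_of_notMem hZ (s := Finset.range k) (i := k) (by simp)
      convert this using 1
      ext ω; simp [hS]
    have hprod : P.map (fun ω => (S ω, Z k ω)) = (P.map S).prod ν := by
      rw [← hlaw k]
      exact (indepFun_iff_map_prod_eq_prod_map_map hSm.aemeasurable (hZ k).aemeasurable).1 hSZ
    set F : H → ℝ≥0∞ := fun s => ENNReal.ofReal (Real.exp (l * Real.sqrt (B + ‖s‖ ^ 2))) with hF
    have hFm : Measurable F := by
      have : Continuous fun s : H => Real.exp (l * Real.sqrt (B + ‖s‖ ^ 2)) := by fun_prop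
      exact this.measurable.ennreal_ofReal
    have hFF : Measurable fun p : H × H => F (p.1 + p.2) :=
      hFm.comp (measurable_fst.add measurable_snd)
    have : IsProbabilityMeasure (P.map S) := Measure.isProbabilityMeasure_map hSm.aemeasurable
    calc ∫⁻ ω, F (∑ j ∈ Finset.range (k + 1), Z j ω) ∂P
        = ∫⁻ ω, (fun p : H × H => F (p.1 + p.2)) (S ω, Z k ω) ∂P := by
          simp only [Finset.sum_range_succ, hS]
      _ = ∫⁻ p, F (p.1 + p.2) ∂(P.map fun ω => (S ω, Z k ω)) := by
          rw [lintegral_map hFF (hSm.prodMk (hZ k))]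
      _ = ∫⁻ s, ∫⁻ z, F (s + z) ∂ν ∂(P.map S) := by
          rw [hprod, lintegral_prod _ hFF.aemeasurable]
      _ ≤ ∫⁻ s, F s * ENNReal.ofReal (Real.exp (l ^ 2 * v + l * L ^ 2 / (2 * Real.sqrt B)))
            ∂(P.map S) :=
          lintegral_mono fun s => lintegral_exp_sqrt_add_le ν hL hmean hvar hl hlL hB hv s
      _ = (∫⁻ ω, F (S ω) ∂P) *
            ENNReal.ofReal (Real.exp (l ^ 2 * v + l * L ^ 2 / (2 * Real.sqrt B))) := by
          rw [lintegral_mul_const _ hFm, lintegral_map hFm hSm]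
      _ ≤ ENNReal.ofReal (Real.exp (l * Real.sqrt B +
            k * (l ^ 2 * v + l * L ^ 2 / (2 * Real.sqrt B)))) *
            ENNReal.ofReal (Real.exp (l ^ 2 * v + l * L ^ 2 / (2 * Real.sqrt B))) := by gcongr
      _ = _ := by
          rw [← ENNReal.ofReal_mul (by positivity), ← Real.exp_add]
          congr 2; push_cast; ring

/-- Exponential tail bound for the norm of a sum of bounded i.i.d. centred Hilbert-space valued
random variables, in terms of the weak variance `v`. -/
lemma measure_norm_sum_ge_le {Z : ℕ → Ω → H} (hZ : ∀ j, Measurable (Z j)) (hind : iIndepFun Z P)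
    (ν : Measure H) [IsProbabilityMeasure ν] (hlaw : ∀ j, P.map (Z j) = ν) {L v : ℝ}
    (hL : ∀ᵐ z ∂ν, ‖z‖ ≤ L) (hmean : ∀ h : H, ∫ z, (inner ℂ h z).re ∂ν = 0)
    (hvar : ∀ h : H, ∫ z, (inner ℂ h z).re ^ 2 ∂ν ≤ v * ‖h‖ ^ 2)
    {l b : ℝ} (hl : 0 ≤ l) (hlL : l * L ≤ 1) (hb : 0 < b) (hv : 0 ≤ v) (n : ℕ) (r : ℝ) :
    P {ω | r ≤ ‖∑ j ∈ Finset.range n, Z j ω‖} ≤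
      ENNReal.ofReal (Real.exp (l * b + n * (l ^ 2 * v + l * L ^ 2 / (2 * b)) - l * r)) := by
  have h := lintegral_exp_sqrt_sum_le hZ hind ν hlaw hL hmean hvar hl hlL
    (show 0 < b ^ 2 by positivity) hv n
  rw [Real.sqrt_sq hb.le] at h
  have hm : Measurable fun ω => ENNReal.ofReal (Real.exp (l * Real.sqrt (b ^ 2 +
      ‖∑ j ∈ Finset.range n, Z j ω‖ ^ 2))) := by
    have h1 : Measurable fun ω => ∑ j ∈ Finset.range n, Z j ω :=
      Finset.measurable_fun_sum _ fun j _ => hZ j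
    have : Continuous fun s : H => Real.exp (l * Real.sqrt (b ^ 2 + ‖s‖ ^ 2)) := by fun_prop
    exact (this.measurable.comp h1).ennreal_ofReal
  have hmk := meas_ge_le_lintegral_div (μ := P) hm.aemeasurable
    (ε := ENNReal.ofReal (Real.exp (l * r))) (by simp [Real.exp_pos]) ENNReal.ofReal_ne_top
  calc P {ω | r ≤ ‖∑ j ∈ Finset.range n, Z j ω‖}
      ≤ P {ω | ENNReal.ofReal (Real.exp (l * r)) ≤ ENNReal.ofReal (Real.exp (l * Real.sqrt (b ^ 2 +
          ‖∑ j ∈ Finset.range n, Z j ω‖ ^ 2)))} := by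
        apply measure_mono
        intro ω hω
        apply ENNReal.ofReal_le_ofReal
        gcongr
        exact (show r ≤ _ from hω).trans (Real.le_sqrt_of_sq_le (by nlinarith [sq_nonneg b]))
    _ ≤ _ := hmk
    _ ≤ ENNReal.ofReal (Real.exp (l * b + n * (l ^ 2 * v + l * L ^ 2 / (2 * b)))) /
          ENNReal.ofReal (Real.exp (l * r)) := by gcongr
    _ = _ := by rw [← ENNReal.ofReal_div_of_pos (Real.exp_pos _), Real.exp_sub]

end HilbertConcentration

/-! ### Fourier inversion and the continuous version of the density -/

section Inversion

lemma densityFourier_eq_charFun_densityLaw {f : Plane → ℝ} (hf_meas : Measurable f)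
    (hf_nonneg : ∀ x, 0 ≤ f x) (t : Plane) :
    densityFourier f t = charFun (densityLaw f) t := by
  have hd : densityLaw f = volume.withDensity (fun x => ((f x).toNNReal : ℝ≥0∞)) := rfl
  rw [charFun_apply, hd, integral_withDensity_eq_integral_smul hf_meas.real_toNNReal]
  refine integral_congr_ae (Eventually.of_forall fun x => ?_)
  simp only [NNReal.smul_def, Real.coe_toNNReal _ (hf_nonneg x), Complex.real_smul]
  rw [real_inner_comm, mul_comm Complex.I, mul_comm]

/-- The inverse Fourier transform of the Fourier transform of `f`. -/
noncomputable def fourierInversion (f : Plane → ℝ) (x : Plane) : ℂ :=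
  ((2 * Real.pi : ℝ) : ℂ)⁻¹ ^ 2 *
    ∫ t : Plane, Complex.exp (-Complex.I * (⟪t, x⟫ : ℝ)) * densityFourier f t

lemma continuous_fourierInversion {f : Plane → ℝ} (hφ : Integrable (densityFourier f) volume) :
    Continuous (fourierInversion f) := by
  refine continuous_const.mul (continuous_of_dominated (bound := fun t => ‖densityFourier f t‖)
    (fun x => ?_) (fun x => Eventually.of_forall fun t => ?_) hφ.norm
    (Eventually.of_forall fun t => ?_))
  · exact (Continuous.aestronglyMeasurable (by fun_prop)).mul hφ.aestronglyMeasurable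
  · rw [norm_mul]
    have : -Complex.I * ((⟪t, x⟫ : ℝ) : ℂ) = ((-⟪t, x⟫ : ℝ) : ℂ) * Complex.I := by
      push_cast; ring
    rw [this, Complex.norm_exp_ofReal_mul_I, one_mul]
  · fun_prop

open FourierTransform in
lemma densityFourier_eq_fourierInv (f : Plane → ℝ) (t : Plane) :
    densityFourier f ((2 * Real.pi) • t) = 𝓕⁻ (fun x => (f x : ℂ)) t := by
  rw [Real.fourierInv_eq', densityFourier]
  refine integral_congr_ae (Eventually.of_forall fun x => ?_)
  simp only [real_inner_smul_left, real_inner_comm t x, smul_eq_mul]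
  rw [mul_comm Complex.I]

-- The factor `(2π)⁻²` is the Jacobian of the rescaling by `2π` that passes between the two Fourier
-- normalisations in dimension two.
open FourierTransform in
lemma fourierInversion_eq_fourier (f : Plane → ℝ) (x : Plane) :
    fourierInversion f x = 𝓕 (𝓕⁻ (fun x => (f x : ℂ))) x := by
  have h := Measure.integral_comp_smul (volume : Measure Plane)
    (fun t => Complex.exp (-Complex.I * (⟪t, x⟫ : ℝ)) * densityFourier f t) (2 * Real.pi)
  rw [Real.fourier_eq', fourierInversion]
  have h2 : ((2 * Real.pi : ℝ) : ℂ)⁻¹ ^ 2 = ((|((2 * Real.pi) ^ Module.finrank ℝ Plane)⁻¹| : ℝ) : ℂ) := by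
    rw [abs_of_nonneg (by positivity), finrank_euclideanSpace_fin]; push_cast; rw [inv_pow]
  rw [h2, ← Complex.real_smul, ← h]
  refine integral_congr_ae (Eventually.of_forall fun t => ?_)
  simp only [densityFourier_eq_fourierInv, smul_eq_mul, real_inner_smul_left]
  congr 2; push_cast; ring

open FourierTransform in
lemma integral_fourier_mul_of_integrable {F G : Plane → ℂ} (hF : Integrable F)
    (hG : Integrable G) : ∫ x, 𝓕 F x * G x = ∫ x, F x * 𝓕 G x := by
  simpa using! VectorFourier.integral_bilin_fourierIntegral_eq_flip (.mul ℂ ℂ) (L := innerₗ Plane)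
    Real.continuous_fourierChar continuous_inner hF hG

open FourierTransform in
lemma integral_fourierInv_mul_of_integrable {F G : Plane → ℂ} (hF : Integrable F)
    (hG : Integrable G) : ∫ x, 𝓕⁻ F x * G x = ∫ x, F x * 𝓕⁻ G x := by
  rw [Real.fourierInv_eq_fourier_comp_neg G, ← integral_fourier_mul_of_integrable hF hG.comp_neg,
    ← integral_neg_eq_self]
  simp [Real.fourierInv_eq_fourier_neg]

open FourierTransform SchwartzMap in
/-- Fourier inversion almost everywhere, for an integrable function whose Fourier transform is
integrable. -/
lemma ae_eq_fourierInversion {f : Plane → ℝ} (hf : Integrable f)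
    (hφ : Integrable (densityFourier f)) : ∀ᵐ x, (f x : ℂ) = fourierInversion f x := by
  have hF : Integrable (fun x => (f x : ℂ)) := hf.ofReal
  have hG : Integrable (𝓕⁻ (fun x => (f x : ℂ))) := by
    have := hφ.comp_smul (R := 2 * Real.pi) (by positivity)
    refine this.congr (Eventually.of_forall fun t => ?_)
    exact densityFourier_eq_fourierInv f t
  refine ae_eq_of_integral_contDiff_smul_eq hF.locallyIntegrable
    (continuous_fourierInversion hφ).locallyIntegrable fun g hg hgc => ?_
  have hgc' : HasCompactSupport (fun x => (g x : ℂ)) := hgc.comp_left (g := Complex.ofReal) rfl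
  have hg' : ContDiff ℝ (⊤ : ℕ∞) (fun x => (g x : ℂ)) := Complex.ofRealCLM.contDiff.comp hg
  obtain ⟨ψ, hψ⟩ : ∃ ψ : 𝓢(Plane, ℂ), ∀ x, ψ x = (g x : ℂ) :=
    ⟨hgc'.toSchwartzMap hg', fun x => rfl⟩
  -- Writing the test function as `𝓕⁻ χ` lets the multiplication formula, used twice, move both
  -- transforms onto `f`; inversion itself is needed only for Schwartz functions.
  obtain ⟨χ, hχ⟩ : ∃ χ : 𝓢(Plane, ℂ), χ = 𝓕 ψ := ⟨_, rfl⟩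
  have e1 : ∀ x, 𝓕⁻ (χ : Plane → ℂ) x = ψ x := fun x => by
    rw [← SchwartzMap.fourierInv_coe, hχ, FourierTransform.fourierInv_fourier_eq]
  have e2 : 𝓕 (ψ : Plane → ℂ) = χ := by rw [hχ, SchwartzMap.fourier_coe]
  calc ∫ x, g x • (f x : ℂ) = ∫ x, (f x : ℂ) * 𝓕⁻ (χ : Plane → ℂ) x := by
        refine integral_congr_ae (Eventually.of_forall fun x => ?_)
        simp only [e1, hψ, Complex.real_smul, mul_comm]
    _ = ∫ x, 𝓕⁻ (fun x => (f x : ℂ)) x * χ x :=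
        (integral_fourierInv_mul_of_integrable hF χ.integrable).symm
    _ = ∫ x, 𝓕 (𝓕⁻ (fun x => (f x : ℂ))) x * ψ x := by
        rw [integral_fourier_mul_of_integrable hG ψ.integrable, e2]
    _ = ∫ x, g x • fourierInversion f x := by
        refine integral_congr_ae (Eventually.of_forall fun x => ?_)
        simp only [fourierInversion_eq_fourier, hψ, Complex.real_smul, mul_comm]

lemma integrable_of_isProbabilityMeasure {f : Plane → ℝ} (hf_meas : Measurable f)
    (hf_nonneg : ∀ x, 0 ≤ f x) [IsProbabilityMeasure (densityLaw f)] : Integrable f := by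
  refine ⟨hf_meas.aestronglyMeasurable, ?_⟩
  rw [hasFiniteIntegral_iff_ofReal (Eventually.of_forall hf_nonneg)]
  have := measure_lt_top (densityLaw f) Set.univ
  rwa [densityLaw, withDensity_apply _ MeasurableSet.univ, setLIntegral_univ] at this

/-- The points of the support where `f = g` have full mass, hence are dense in the support.
Continuity of `f` relative to the support suffices to pass to the limit along them. -/
lemma eqOn_densitySupport {f : Plane → ℝ} {g : Plane → ℂ}
    (hg : Continuous g) (hfg : ∀ᵐ x, (f x : ℂ) = g x) (hf : ContinuousOn f (densitySupport f)) :
    ∀ x ∈ densitySupport f, (f x : ℂ) = g x := by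
  intro x hx
  set s := {y | y ∈ densitySupport f ∧ (f y : ℂ) = g y} with hs
  have hae : ∀ᵐ y ∂(densityLaw f), y ∈ s := by
    have h1 : ∀ᵐ y ∂(densityLaw f), y ∈ densitySupport f := Measure.support_mem_ae
    have h2 : ∀ᵐ y ∂(densityLaw f), (f y : ℂ) = g y :=
      (withDensity_absolutelyContinuous _ _).ae_le hfg
    exact h1.and h2
  have hcl : x ∈ closure s := by
    rw [mem_closure_iff_nhds]
    intro U hU
    have hpos := (Measure.mem_support_iff_forall x).1 hx U hU
    by_contra hne
    rw [Set.not_nonempty_iff_eq_empty] at hne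
    have hsub : U ⊆ {y | ¬ y ∈ s} := fun y hy hys =>
      (Set.mem_empty_iff_false y).1 (hne ▸ Set.mem_inter hy hys)
    exact hpos.ne' (measure_mono_null hsub (ae_iff.1 hae))
  have hne : (𝓝[s] x).NeBot := mem_closure_iff_nhdsWithin_neBot.1 hcl
  have hfc : Tendsto (fun y => (f y : ℂ)) (𝓝[s] x) (𝓝 (f x : ℂ)) :=
    (Complex.continuous_ofReal.tendsto _).comp
      ((hf x hx).mono_left (nhdsWithin_mono x fun y hy => hy.1))
  have hgc : Tendsto g (𝓝[s] x) (𝓝 (g x)) := hg.continuousAt.tendsto.mono_left nhdsWithin_le_nhds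
  refine tendsto_nhds_unique (hfc.congr' ?_) hgc
  filter_upwards [self_mem_nhdsWithin] with y hy using hy.2

/-- The complement of the support is open, and a continuous function vanishing almost everywhere on
an open set vanishes there. -/
lemma eq_zero_off_densitySupport {f : Plane → ℝ} {g : Plane → ℂ}
    (hg : Continuous g) (hfg : ∀ᵐ x, (f x : ℂ) = g x) (hf : ∀ x ∉ densitySupport f, f x = 0) :
    ∀ x ∉ densitySupport f, g x = 0 := by
  intro x hx
  have hopen : IsOpen (densitySupport f)ᶜ := Measure.isOpen_compl_support
  have h : ∀ᵐ y ∂(volume.restrict (densitySupport f)ᶜ), g y = 0 := by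
    filter_upwards [ae_restrict_of_ae hfg, ae_restrict_mem hopen.measurableSet] with y hy hy'
    rw [← hy, hf y hy']; simp
  exact Measure.eqOn_open_of_ae_eq (g := fun _ => (0 : ℂ)) h hopen hg.continuousOn
    continuousOn_const hx

end Inversion

/-! ### Centred characters as random vectors in `L²(ρ)`, and their weak variance -/

section CenteredCharacter

/-- The character `exp(i t'x)`, centred by its mean under `μ`. -/
noncomputable def centeredChar (μ : Measure Plane) (x t : Plane) : ℂ :=
  Complex.exp (Complex.I * (⟪t, x⟫ : ℝ)) - charFun μ t

lemma norm_exp_I_mul_ofReal_eq_one (a : ℝ) : ‖Complex.exp (Complex.I * (a : ℂ))‖ = 1 := by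
  rw [mul_comm]; exact Complex.norm_exp_ofReal_mul_I a

variable (μ : Measure Plane) [IsProbabilityMeasure μ]

lemma continuous_centeredChar : Continuous fun p : Plane × Plane => centeredChar μ p.1 p.2 := by
  unfold centeredChar
  have := continuous_charFun (μ := μ)
  fun_prop

lemma norm_centeredChar_le (x t : Plane) : ‖centeredChar μ x t‖ ≤ 2 := by
  refine (norm_sub_le _ _).trans ?_
  rw [norm_exp_I_mul_ofReal_eq_one]
  linarith [norm_charFun_le_one (μ := μ) t]

lemma integrable_exp_inner (t : Plane) :
    Integrable (fun x : Plane => Complex.exp (Complex.I * (⟪t, x⟫ : ℝ))) μ :=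
  Integrable.of_bound (Continuous.aestronglyMeasurable (by fun_prop)) 1
    (Eventually.of_forall fun x => (norm_exp_I_mul_ofReal_eq_one _).le)

omit [IsProbabilityMeasure μ] in
lemma integral_exp_inner (t : Plane) :
    ∫ x : Plane, Complex.exp (Complex.I * (⟪t, x⟫ : ℝ)) ∂μ = charFun μ t := by
  rw [charFun_apply]
  simp only [real_inner_comm t, mul_comm Complex.I]

lemma integral_centeredChar (t : Plane) : ∫ x, centeredChar μ x t ∂μ = 0 := by
  unfold centeredChar
  rw [integral_sub (integrable_exp_inner μ t) (integrable_const _), integral_exp_inner]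
  simp

variable (ρ : Measure Plane) [IsFiniteMeasure ρ]

lemma memLp_centeredChar (x : Plane) : MemLp (centeredChar μ x) 2 ρ :=
  MemLp.of_bound ((continuous_centeredChar μ).comp
    (Continuous.prodMk_right x)).aestronglyMeasurable 2
    (Eventually.of_forall fun t => norm_centeredChar_le μ x t)

/-- The centred character as an element of `L²(ρ)`. -/
noncomputable def centeredCharLp (x : Plane) : Lp ℂ 2 ρ := (memLp_centeredChar μ ρ x).toLp

lemma norm_toLp_sq {α : Type*} [MeasurableSpace α] {ρ : Measure α} {F : α → ℂ}
    (hF : MemLp F 2 ρ) : ‖hF.toLp F‖ ^ 2 = ∫ t, ‖F t‖ ^ 2 ∂ρ := by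
  have h : inner ℂ (hF.toLp F) (hF.toLp F) = ((∫ t, ‖F t‖ ^ 2 ∂ρ : ℝ) : ℂ) := by
    rw [L2.inner_def, ← integral_complex_ofReal]
    refine integral_congr_ae ?_
    filter_upwards [hF.coeFn_toLp] with t ht
    rw [ht, inner_self_eq_norm_sq_to_K]; simp
  rw [inner_self_eq_norm_sq_to_K, ← RCLike.ofReal_pow] at h
  exact Complex.ofReal_injective h

/-- Dominated convergence applies to the squared distance, since characters are bounded and `ρ` is
finite. Continuity supplies the measurability needed for concentration. -/
lemma continuous_centeredCharLp : Continuous (centeredCharLp μ ρ) := by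
  have hc := continuous_centeredChar μ
  rw [continuous_iff_continuousAt]
  intro x
  have h2 : ∀ y, ‖centeredCharLp μ ρ y - centeredCharLp μ ρ x‖ ^ 2 =
      ∫ t, ‖centeredChar μ y t - centeredChar μ x t‖ ^ 2 ∂ρ := fun y => by
    rw [centeredCharLp, centeredCharLp, ← MemLp.toLp_sub, norm_toLp_sq]; rfl
  have hcont : Continuous fun y => ∫ t, ‖centeredChar μ y t - centeredChar μ x t‖ ^ 2 ∂ρ := by
    refine continuous_of_dominated (bound := fun _ => 4 ^ 2) (fun y => ?_) (fun y => ?_)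
      (integrable_const _) ?_
    · exact ((((hc.comp (Continuous.prodMk_right y)).sub
        (hc.comp (Continuous.prodMk_right x))).norm).pow 2).aestronglyMeasurable
    · refine Eventually.of_forall fun t => ?_
      rw [norm_pow, norm_norm]
      have := norm_sub_le (centeredChar μ y t) (centeredChar μ x t)
      gcongr
      linarith [norm_centeredChar_le μ x t, norm_centeredChar_le μ y t]
    · exact Eventually.of_forall fun t =>
        (((hc.comp (Continuous.prodMk_left t)).sub continuous_const).norm).pow 2
  have hlim : Tendsto (fun y => ‖centeredCharLp μ ρ y - centeredCharLp μ ρ x‖ ^ 2) (𝓝 x) (𝓝 0) := by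
    simp only [h2]
    simpa using hcont.tendsto x
  rw [ContinuousAt, tendsto_iff_norm_sub_tendsto_zero]
  have := (Real.continuous_sqrt.tendsto 0).comp hlim
  simpa [Function.comp_def, Real.sqrt_sq] using this

lemma norm_centeredCharLp_le (x : Plane) :
    ‖centeredCharLp μ ρ x‖ ≤ 2 * Real.sqrt (ρ.real Set.univ) := by
  apply le_of_sq_le_sq _ (by positivity)
  rw [centeredCharLp, norm_toLp_sq, mul_pow, Real.sq_sqrt (by positivity)]
  have h := integral_mono_of_nonneg (μ := ρ) (f := fun t => ‖centeredChar μ x t‖ ^ 2)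
    (g := fun _ => (2 : ℝ) ^ 2) (Eventually.of_forall fun t => by positivity) (integrable_const _)
    (Eventually.of_forall fun t => by
      have := norm_centeredChar_le μ x t
      simp only
      gcongr)
  simp only [integral_const, smul_eq_mul] at h
  linarith

lemma inner_centeredCharLp (h : Lp ℂ 2 ρ) (x : Plane) :
    inner ℂ h (centeredCharLp μ ρ x) = ∫ t, centeredChar μ x t * starRingEnd ℂ (h t) ∂ρ := by
  rw [L2.inner_def]
  refine integral_congr_ae ?_
  filter_upwards [(memLp_centeredChar μ ρ x).coeFn_toLp] with t ht
  rw [centeredCharLp, ht, RCLike.inner_apply]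

lemma integrable_conj_Lp (h : Lp ℂ 2 ρ) : Integrable (fun t => starRingEnd ℂ (h t)) ρ :=
  RCLike.conjCLE.toContinuousLinearMap.integrable_comp
    ((Lp.memLp h).integrable (by norm_num))

lemma integral_inner_centeredCharLp (h : Lp ℂ 2 ρ) :
    ∫ x, inner ℂ h (centeredCharLp μ ρ x) ∂μ = 0 := by
  simp only [inner_centeredCharLp]
  rw [integral_integral_swap]
  · simp [integral_mul_const, integral_centeredChar]
  · refine Integrable.bdd_mul (c := 2) ((integrable_conj_Lp ρ h).comp_snd μ)
      (continuous_centeredChar μ).aestronglyMeasurable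
      (Eventually.of_forall fun p => norm_centeredChar_le μ p.1 p.2)

/-- The Fourier integral of the conjugate of `h` against `ρ`. -/
noncomputable def charIntegral (h : Lp ℂ 2 ρ) (x : Plane) : ℂ :=
  ∫ t, Complex.exp (Complex.I * (⟪t, x⟫ : ℝ)) * starRingEnd ℂ (h t) ∂ρ

lemma integrable_exp_mul_conj (h : Lp ℂ 2 ρ) (x : Plane) :
    Integrable (fun t => Complex.exp (Complex.I * (⟪t, x⟫ : ℝ)) * starRingEnd ℂ (h t)) ρ :=
  Integrable.bdd_mul (c := 1) (integrable_conj_Lp ρ h)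
    (Continuous.aestronglyMeasurable (by fun_prop))
    (Eventually.of_forall fun p => (norm_exp_I_mul_ofReal_eq_one _).le)

lemma continuous_charIntegral (h : Lp ℂ 2 ρ) : Continuous (charIntegral ρ h) := by
  refine continuous_of_dominated (bound := fun t => ‖starRingEnd ℂ (h t)‖)
    (fun x => (integrable_exp_mul_conj ρ h x).aestronglyMeasurable)
    (fun x => Eventually.of_forall fun t => ?_) (integrable_conj_Lp ρ h).norm
    (Eventually.of_forall fun t => by fun_prop)
  rw [norm_mul, norm_exp_I_mul_ofReal_eq_one, one_mul]

omit [IsFiniteMeasure ρ] in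
lemma norm_charIntegral_le (h : Lp ℂ 2 ρ) (x : Plane) :
    ‖charIntegral ρ h x‖ ≤ ∫ t, ‖h t‖ ∂ρ := by
  refine (norm_integral_le_integral_norm _).trans_eq ?_
  simp

/-- Schur test: the weak variance is at most the `L¹` norm of the characteristic function. -/
lemma integral_norm_charIntegral_sq_le (hφ : Integrable (charFun μ) volume) (hρ : ρ ≤ volume)
    (h : Lp ℂ 2 ρ) :
    ∫ x, ‖charIntegral ρ h x‖ ^ 2 ∂μ ≤ (∫ t, ‖charFun μ t‖) * ‖h‖ ^ 2 := by
  have hh1 : Integrable (fun t => h t) ρ := (Lp.memLp h).integrable (by norm_num)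
  have hcj := integrable_conj_Lp ρ h
  have hh2 : Integrable (fun t => ‖h t‖ ^ 2) ρ :=
    (Lp.memLp h).integrable_norm_pow (p := 2) (by norm_num)
  have hnorm : ∫ t, ‖h t‖ ^ 2 ∂ρ = ‖h‖ ^ 2 := by
    rw [← norm_toLp_sq (Lp.memLp h), Lp.toLp_coeFn]
  -- Expanding the square as a double integral makes `x` appear only through the character at `p.1 -
  -- p.2`, whose mean is the characteristic function there.
  have hpt : ∀ x, ((‖charIntegral ρ h x‖ ^ 2 : ℝ) : ℂ) = ∫ p : Plane × Plane,
      Complex.exp (Complex.I * (⟪p.1 - p.2, x⟫ : ℝ)) * (starRingEnd ℂ (h p.1) * h p.2)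
        ∂(ρ.prod ρ) := fun x => by
    have e1 : ((‖charIntegral ρ h x‖ ^ 2 : ℝ) : ℂ) =
        charIntegral ρ h x * starRingEnd ℂ (charIntegral ρ h x) := by
      rw [Complex.mul_conj, Complex.normSq_eq_norm_sq]
    rw [e1, charIntegral, ← integral_conj, ← integral_prod_mul]
    refine integral_congr_ae (Eventually.of_forall fun p => ?_)
    simp only [map_mul, ← Complex.exp_conj, Complex.conj_I, Complex.conj_ofReal, Complex.conj_conj,
      inner_sub_left, Complex.ofReal_sub, mul_sub, Complex.exp_sub, neg_mul, Complex.exp_neg]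
    ring
  have hswap : ((∫ x, ‖charIntegral ρ h x‖ ^ 2 ∂μ : ℝ) : ℂ) = ∫ p : Plane × Plane,
      charFun μ (p.1 - p.2) * (starRingEnd ℂ (h p.1) * h p.2) ∂(ρ.prod ρ) := by
    rw [← integral_complex_ofReal]
    simp only [hpt]
    rw [integral_integral_swap]
    · simp only [integral_mul_const, integral_exp_inner]
    · refine Integrable.bdd_mul (c := 1) ((hcj.mul_prod hh1).comp_snd μ)
        (Continuous.aestronglyMeasurable (by fun_prop))
        (Eventually.of_forall fun p => (norm_exp_I_mul_ofReal_eq_one _).le)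
  have hcφ : Continuous fun p : Plane × Plane => ‖charFun μ (p.1 - p.2)‖ := by
    have := continuous_charFun (μ := μ)
    fun_prop
  have hi1 : Integrable (fun p : Plane × Plane => ‖charFun μ (p.1 - p.2)‖ * ‖h p.1‖ ^ 2)
      (ρ.prod ρ) :=
    Integrable.bdd_mul (c := 1) (hh2.comp_fst ρ) hcφ.aestronglyMeasurable
      (Eventually.of_forall fun p => by rw [norm_norm]; exact norm_charFun_le_one _)
  have hi2 : Integrable (fun p : Plane × Plane => ‖charFun μ (p.1 - p.2)‖ * ‖h p.2‖ ^ 2)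
      (ρ.prod ρ) :=
    Integrable.bdd_mul (c := 1) (hh2.comp_snd ρ) hcφ.aestronglyMeasurable
      (Eventually.of_forall fun p => by rw [norm_norm]; exact norm_charFun_le_one _)
  have hφn := hφ.norm
  -- Rows, and then columns, of the kernel: enlarging `ρ` to Lebesgue measure and translating
  -- removes all dependence on `ρ`.
  have hb1 : ∀ t, ∫ s, ‖charFun μ (t - s)‖ ∂ρ ≤ ∫ t, ‖charFun μ t‖ := fun t => by
    rw [← integral_sub_left_eq_self (fun s => ‖charFun μ s‖) volume t]
    exact integral_mono_measure hρ (Eventually.of_forall fun s => norm_nonneg _)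
      (hφn.comp_sub_left t)
  have hb2 : ∀ s, ∫ t, ‖charFun μ (t - s)‖ ∂ρ ≤ ∫ t, ‖charFun μ t‖ := fun s => by
    rw [← integral_sub_right_eq_self (fun t => ‖charFun μ t‖) s]
    exact integral_mono_measure hρ (Eventually.of_forall fun s => norm_nonneg _)
      (hφn.comp_sub_right s)
  have hB1 : ∫ p : Plane × Plane, ‖charFun μ (p.1 - p.2)‖ * ‖h p.1‖ ^ 2 ∂(ρ.prod ρ) ≤
      (∫ t, ‖charFun μ t‖) * ‖h‖ ^ 2 := by
    rw [integral_prod _ hi1, ← hnorm, ← integral_const_mul]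
    refine integral_mono hi1.integral_prod_left (hh2.const_mul _) fun t => ?_
    simp only [integral_mul_const]
    gcongr
    exact hb1 t
  have hB2 : ∫ p : Plane × Plane, ‖charFun μ (p.1 - p.2)‖ * ‖h p.2‖ ^ 2 ∂(ρ.prod ρ) ≤
      (∫ t, ‖charFun μ t‖) * ‖h‖ ^ 2 := by
    rw [integral_prod_symm _ hi2, ← hnorm, ← integral_const_mul]
    refine integral_mono hi2.integral_prod_right (hh2.const_mul _) fun t => ?_
    simp only [integral_mul_const]
    gcongr
    exact hb2 t
  calc ∫ x, ‖charIntegral ρ h x‖ ^ 2 ∂μ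
      ≤ ‖((∫ x, ‖charIntegral ρ h x‖ ^ 2 ∂μ : ℝ) : ℂ)‖ := by
        rw [Complex.norm_real]; exact le_abs_self _
    _ ≤ ∫ p : Plane × Plane, (‖charFun μ (p.1 - p.2)‖ * ‖h p.1‖ ^ 2 +
          ‖charFun μ (p.1 - p.2)‖ * ‖h p.2‖ ^ 2) / 2 ∂(ρ.prod ρ) := by
        rw [hswap]
        refine norm_integral_le_of_norm_le ((hi1.add hi2).div_const 2)
          (Eventually.of_forall fun p => ?_)
        rw [norm_mul, norm_mul, RCLike.norm_conj]
        nlinarith [mul_nonneg (norm_nonneg (charFun μ (p.1 - p.2))) (sq_nonneg (‖h p.1‖ - ‖h p.2‖))]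
    _ = (∫ p : Plane × Plane, ‖charFun μ (p.1 - p.2)‖ * ‖h p.1‖ ^ 2 ∂(ρ.prod ρ) +
          ∫ p : Plane × Plane, ‖charFun μ (p.1 - p.2)‖ * ‖h p.2‖ ^ 2 ∂(ρ.prod ρ)) / 2 := by
        rw [integral_div, integral_add hi1 hi2]
    _ ≤ _ := by linarith

lemma integrable_of_continuous_of_bound {E : Type*} [NormedAddCommGroup E] {F : Plane → E}
    [SecondCountableTopology E] (hF : Continuous F) (C : ℝ) (hC : ∀ x, ‖F x‖ ≤ C) :
    Integrable F μ :=
  Integrable.of_bound hF.aestronglyMeasurable C (Eventually.of_forall hC)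

/-- Centring only lowers the second moment, so the Schur bound for uncentred characters carries
over. -/
lemma integral_re_inner_sq_le (hφ : Integrable (charFun μ) volume) (hρ : ρ ≤ volume)
    (h : Lp ℂ 2 ρ) :
    ∫ x, (inner ℂ h (centeredCharLp μ ρ x)).re ^ 2 ∂μ ≤ (∫ t, ‖charFun μ t‖) * ‖h‖ ^ 2 := by
  set m : ℂ := ∫ t, charFun μ t * starRingEnd ℂ (h t) ∂ρ with hm
  set C := ∫ t, ‖h t‖ ∂ρ with hC
  have hcI := continuous_charIntegral ρ h
  have hmint : Integrable (fun t => charFun μ t * starRingEnd ℂ (h t)) ρ :=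
    Integrable.bdd_mul (c := 1) (integrable_conj_Lp ρ h)
      (continuous_charFun (μ := μ)).aestronglyMeasurable
      (Eventually.of_forall fun t => norm_charFun_le_one t)
  have hsub : ∀ x, inner ℂ h (centeredCharLp μ ρ x) = charIntegral ρ h x - m := fun x => by
    rw [inner_centeredCharLp, charIntegral, hm, ← integral_sub (integrable_exp_mul_conj ρ h x) hmint]
    simp only [centeredChar, sub_mul]
  have hIint : Integrable (charIntegral ρ h) μ :=
    integrable_of_continuous_of_bound μ hcI C (norm_charIntegral_le ρ h)
  have hreint : Integrable (fun x => (charIntegral ρ h x).re) μ := hIint.re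
  have hn2 : Integrable (fun x => ‖charIntegral ρ h x‖ ^ 2) μ :=
    integrable_of_continuous_of_bound μ (by fun_prop) (C ^ 2) fun x => by
      rw [norm_pow, norm_norm]
      gcongr
      exact norm_charIntegral_le ρ h x
  have hre2 : Integrable (fun x => (charIntegral ρ h x).re ^ 2) μ := by
    refine hn2.mono ((Complex.continuous_re.comp hcI).pow 2).aestronglyMeasurable
      (Eventually.of_forall fun x => ?_)
    rw [norm_pow, norm_pow, norm_norm]
    gcongr
    exact Complex.abs_re_le_norm _
  have hmean : ∫ x, (charIntegral ρ h x).re ∂μ = m.re := by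
    have h0 := integral_inner_centeredCharLp μ ρ h
    simp only [hsub] at h0
    rw [integral_sub hIint (integrable_const _)] at h0
    have h1 : ∫ x, charIntegral ρ h x ∂μ = m := by
      simpa [sub_eq_zero] using h0
    rw [← h1]
    exact integral_re hIint
  calc ∫ x, (inner ℂ h (centeredCharLp μ ρ x)).re ^ 2 ∂μ
      = ∫ x, ((charIntegral ρ h x).re ^ 2 - (2 * m.re) * (charIntegral ρ h x).re + m.re ^ 2) ∂μ := by
        refine integral_congr_ae (Eventually.of_forall fun x => ?_)
        simp only [hsub, Complex.sub_re]; ring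
    _ = ∫ x, (charIntegral ρ h x).re ^ 2 ∂μ - m.re ^ 2 := by
        rw [integral_add (f := fun x => (charIntegral ρ h x).re ^ 2 -
            2 * m.re * (charIntegral ρ h x).re) (hre2.sub (hreint.const_mul _))
            (integrable_const _),
          integral_sub hre2 (hreint.const_mul _), integral_const_mul, hmean]
        simp; ring
    _ ≤ ∫ x, ‖charIntegral ρ h x‖ ^ 2 ∂μ := by
        have : ∫ x, (charIntegral ρ h x).re ^ 2 ∂μ ≤ ∫ x, ‖charIntegral ρ h x‖ ^ 2 ∂μ :=
          integral_mono hre2 hn2 fun x => by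
            simp only
            rw [← sq_abs]
            gcongr
            exact Complex.abs_re_le_norm _
        linarith [sq_nonneg m.re]
    _ ≤ _ := integral_norm_charIntegral_sq_le μ ρ hφ hρ h

end CenteredCharacter

/-! ### Almost sure `L¹` convergence of the empirical characteristic function on growing windows -/

section EmpiricalCharacteristicFunction

/-- Cauchy-Schwarz against the constant `1`, read off from `∫ (V ‖G‖ - a)² ≥ 0`; dividing by `V`
forces the null measure to be treated apart. -/
lemma integral_norm_le_sqrt_mul_norm {α : Type*} [MeasurableSpace α] {ρ : Measure α}
    [IsFiniteMeasure ρ] (G : Lp ℂ 2 ρ) :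
    ∫ t, ‖G t‖ ∂ρ ≤ Real.sqrt (ρ.real Set.univ) * ‖G‖ := by
  have h1 : Integrable (fun t => ‖G t‖) ρ := ((Lp.memLp G).integrable (by norm_num)).norm
  have h2 : Integrable (fun t => ‖G t‖ ^ 2) ρ :=
    (Lp.memLp G).integrable_norm_pow (p := 2) (by norm_num)
  have hnorm : ∫ t, ‖G t‖ ^ 2 ∂ρ = ‖G‖ ^ 2 := by
    rw [← norm_toLp_sq (Lp.memLp G), Lp.toLp_coeFn]
  set V := ρ.real Set.univ with hV
  set a := ∫ t, ‖G t‖ ∂ρ with ha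
  have hV0 : 0 ≤ V := measureReal_nonneg
  have hexp : ∫ t, (V * ‖G t‖ - a) ^ 2 ∂ρ = V * (V * ‖G‖ ^ 2 - a ^ 2) := by
    calc ∫ t, (V * ‖G t‖ - a) ^ 2 ∂ρ
        = ∫ t, ((V ^ 2 * ‖G t‖ ^ 2 - (2 * V * a) * ‖G t‖) + a ^ 2) ∂ρ := by
          refine integral_congr_ae (Eventually.of_forall fun t => ?_)
          simp only; ring
      _ = _ := by
          rw [integral_add (f := fun t => V ^ 2 * ‖G t‖ ^ 2 - (2 * V * a) * ‖G t‖)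
              ((h2.const_mul _).sub (h1.const_mul _)) (integrable_const _),
            integral_sub (h2.const_mul _) (h1.const_mul _), integral_const_mul,
            integral_const_mul, hnorm, ← ha]
          simp only [integral_const, smul_eq_mul, ← hV]; ring
  rcases hV0.eq_or_lt with h0 | hpos
  · have hρ0 : ρ = 0 := by
      rw [← Measure.measure_univ_eq_zero]
      exact (measureReal_eq_zero_iff (measure_ne_top _ _)).1 h0.symm
    have hae : ∀ p : α → Prop, ∀ᵐ t ∂ρ, p t := fun p => by rw [hρ0]; simp
    have : a = 0 := integral_eq_zero_of_ae (hae _)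
    rw [this]; positivity
  · have hnn : 0 ≤ V * (V * ‖G‖ ^ 2 - a ^ 2) :=
      hexp ▸ integral_nonneg fun t => sq_nonneg _
    have : a ^ 2 ≤ V * ‖G‖ ^ 2 := by
      have := nonneg_of_mul_nonneg_right hnn hpos
      linarith
    apply le_of_sq_le_sq _ (by positivity)
    rwa [mul_pow, Real.sq_sqrt hV0]

variable (μ : Measure Plane) [IsProbabilityMeasure μ] (ρ : Measure Plane) [IsFiniteMeasure ρ]

lemma coeFn_sum_centeredCharLp (x : ℕ → Plane) (n : ℕ) :
    (∑ j ∈ Finset.range n, centeredCharLp μ ρ (x j) : Lp ℂ 2 ρ) =ᵐ[ρ]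
      fun t => ∑ j ∈ Finset.range n, centeredChar μ (x j) t := by
  induction n with
  | zero => simpa [Pi.zero_def] using Lp.coeFn_zero ℂ 2 ρ
  | succ k ih =>
    simp only [Finset.sum_range_succ]
    filter_upwards [Lp.coeFn_add (∑ j ∈ Finset.range k, centeredCharLp μ ρ (x j))
      (centeredCharLp μ ρ (x k)), ih, (memLp_centeredChar μ ρ (x k)).coeFn_toLp] with t h1 h2 h3
    rw [h1, Pi.add_apply, h2]
    congr 1

lemma integral_norm_ecf_sub_le (x : ℕ → Plane) {n : ℕ} (hn : n ≠ 0) :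
    ∫ t, ‖ecf x n t - charFun μ t‖ ∂ρ ≤ (n : ℝ)⁻¹ *
      (Real.sqrt (ρ.real Set.univ) * ‖∑ j ∈ Finset.range n, centeredCharLp μ ρ (x j)‖) := by
  have hn' : (n : ℂ) ≠ 0 := by exact_mod_cast hn
  have h : ∫ t, ‖ecf x n t - charFun μ t‖ ∂ρ = (n : ℝ)⁻¹ *
      ∫ t, ‖(∑ j ∈ Finset.range n, centeredCharLp μ ρ (x j) : Lp ℂ 2 ρ) t‖ ∂ρ := by
    rw [← integral_const_mul]
    refine integral_congr_ae ?_
    filter_upwards [coeFn_sum_centeredCharLp μ ρ x n] with t ht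
    have : ecf x n t - charFun μ t = (n : ℂ)⁻¹ * ∑ j ∈ Finset.range n, centeredChar μ (x j) t := by
      simp only [ecf, centeredChar, Finset.sum_sub_distrib, Finset.sum_const, Finset.card_range,
        nsmul_eq_mul, mul_sub]
      field_simp
    rw [ht, this, norm_mul, norm_inv, Complex.norm_natCast]
  rw [h]
  gcongr
  exact integral_norm_le_sqrt_mul_norm _

variable {Ω : Type*} [MeasurableSpace Ω] {P : Measure Ω} [IsProbabilityMeasure P]
  {X : ℕ → Ω → Plane}

/-- The tail bound is used with `r = ε n / √W`, `b = r / 4`, `l = c / √W`, `L = 2 √W`. Of the gain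
`l r = c ε n / W`, one quarter each pays for `l b`, for the variance term (by `hcv`) and for the
second-order term (by `hWn`). The last quarter is at least `c ε √n / 4` by `hWn'`. -/
lemma measure_integral_norm_ecf_sub_ge_le (hX_meas : ∀ j, Measurable (X j))
    (hX_indep : iIndepFun X P) (hX_law : ∀ j, P.map (X j) = μ)
    (hφ : Integrable (charFun μ) volume) (hρ : ρ ≤ volume) {n : ℕ} {W ε c : ℝ}
    (hW : 1 ≤ W) (hρW : ρ.real Set.univ ≤ W) (hε : 0 < ε) (hWn : 32 * W ^ 2 ≤ ε ^ 2 * n)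
    (hWn' : W ≤ Real.sqrt n) (hc : 0 < c) (hc2 : c ≤ 1 / 2)
    (hcv : c * (∫ t, ‖charFun μ t‖) ≤ ε / 4) :
    P {ω | ε ≤ ∫ t, ‖ecf (fun j => X j ω) n t - charFun μ t‖ ∂ρ} ≤
      ENNReal.ofReal (Real.exp (-(c * ε / 4 * Real.sqrt n))) := by
  let _ : MeasurableSpace (Lp ℂ 2 ρ) := borel _
  have : BorelSpace (Lp ℂ 2 ρ) := ⟨rfl⟩
  have : Fact ((2 : ℝ≥0∞) ≠ ∞) := ⟨by norm_num⟩
  set v := ∫ t, ‖charFun μ t‖ with hv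
  have hsW : 0 < Real.sqrt W := Real.sqrt_pos.2 (by linarith)
  have hsW2 : Real.sqrt W ^ 2 = W := Real.sq_sqrt (by linarith)
  have hnpos : (0 : ℝ) < n := by
    by_contra hcon
    have : 0 < 32 * W ^ 2 := by positivity
    nlinarith [sq_nonneg ε]
  have hn0 : n ≠ 0 := by rintro rfl; simp at hnpos
  have hmeas : Measurable (centeredCharLp μ ρ) := (continuous_centeredCharLp μ ρ).measurable
  set Z : ℕ → Ω → Lp ℂ 2 ρ := fun j ω => centeredCharLp μ ρ (X j ω) with hZ
  set ν := μ.map (centeredCharLp μ ρ) with hν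
  have : IsProbabilityMeasure ν := Measure.isProbabilityMeasure_map hmeas.aemeasurable
  have hlaw : ∀ j, P.map (Z j) = ν := fun j => by
    have := Measure.map_map (μ := P) hmeas (hX_meas j)
    rw [hX_law j] at this
    exact this.symm
  have hre : ∀ h : Lp ℂ 2 ρ, Continuous fun z : Lp ℂ 2 ρ => (inner ℂ h z).re := fun h =>
    Complex.continuous_re.comp (continuous_const.inner continuous_id)
  have key := measure_norm_sum_ge_le (P := P) (Z := Z) (fun j => hmeas.comp (hX_meas j))
    (hX_indep.comp (fun _ => centeredCharLp μ ρ) fun _ => hmeas) ν hlaw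
    (L := 2 * Real.sqrt W) (v := v) ?_ ?_ ?_ (l := c / Real.sqrt W)
    (b := ε * n / Real.sqrt W / 4) (by positivity) ?_ (by positivity)
    (integral_nonneg fun t => norm_nonneg _) n (ε * n / Real.sqrt W)
  · refine (measure_mono fun ω hω => ?_).trans (key.trans ?_)
    · have h1 : ε ≤ _ := le_trans hω (integral_norm_ecf_sub_le μ ρ (fun j => X j ω) hn0)
      have h2 : Real.sqrt (ρ.real Set.univ) ≤ Real.sqrt W := Real.sqrt_le_sqrt hρW
      change ε * n / Real.sqrt W ≤ ‖∑ j ∈ Finset.range n, centeredCharLp μ ρ (X j ω)‖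
      set N := ‖∑ j ∈ Finset.range n, centeredCharLp μ ρ (X j ω)‖
      have h3 : ε ≤ (n : ℝ)⁻¹ * (Real.sqrt W * N) := h1.trans (by gcongr)
      rw [div_le_iff₀ hsW]
      calc ε * n ≤ (n : ℝ)⁻¹ * (Real.sqrt W * N) * n := by gcongr
        _ = N * Real.sqrt W := by field_simp
    · apply ENNReal.ofReal_le_ofReal
      apply Real.exp_le_exp.2
      have e1 : c / Real.sqrt W * (ε * n / Real.sqrt W / 4) +
          n * ((c / Real.sqrt W) ^ 2 * v + c / Real.sqrt W * (2 * Real.sqrt W) ^ 2 /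
            (2 * (ε * n / Real.sqrt W / 4))) - c / Real.sqrt W * (ε * n / Real.sqrt W) =
          n / W * (c * (c * v)) + 8 * c * W / ε - 3 / 4 * (c * ε * (n / W)) := by
        -- A free variable `w` for `√W` allows `W` to be eliminated as `w ^ 2`, leaving a rational
        -- identity.
        have hs : ∀ w : ℝ, 0 < w → w ^ 2 = W → c / w * (ε * n / w / 4) +
            n * ((c / w) ^ 2 * v + c / w * (2 * w) ^ 2 / (2 * (ε * n / w / 4))) -
            c / w * (ε * n / w) =
            n / W * (c * (c * v)) + 8 * c * W / ε - 3 / 4 * (c * ε * (n / W)) := by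
          rintro w hw rfl
          field_simp
          ring
        exact hs _ hsW hsW2
      rw [e1]
      have hnW : 0 < n / W := by positivity
      have e2 : n / W * (c * (c * v)) ≤ n / W * (c * (ε / 4)) := by gcongr
      have e3 : 8 * c * W / ε ≤ c * ε * (n / W) / 4 := by
        rw [div_le_iff₀ hε]
        have : c * ε * (n / W) / 4 * ε = c * (ε ^ 2 * n) / (4 * W) := by field_simp
        rw [this, le_div_iff₀ (by positivity)]
        nlinarith
      have e4 : Real.sqrt n ≤ n / W := by
        rw [le_div_iff₀ (by linarith)]
        calc Real.sqrt n * W ≤ Real.sqrt n * Real.sqrt n := by gcongr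
          _ = n := Real.mul_self_sqrt hnpos.le
      have e5 : c * ε / 4 * Real.sqrt n ≤ c * ε / 4 * (n / W) := by gcongr
      linarith
  · rw [hν, ae_map_iff hmeas.aemeasurable (measurableSet_le measurable_norm measurable_const)]
    refine Eventually.of_forall fun x => (norm_centeredCharLp_le μ ρ x).trans ?_
    gcongr
  · intro h
    rw [hν, integral_map hmeas.aemeasurable (hre h).aestronglyMeasurable]
    have hi : Integrable (fun x => inner ℂ h (centeredCharLp μ ρ x)) μ :=
      integrable_of_continuous_of_bound μ
        (continuous_const.inner (continuous_centeredCharLp μ ρ))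
        (‖h‖ * (2 * Real.sqrt (ρ.real Set.univ))) fun x => (norm_inner_le_norm _ _).trans (by
          gcongr; exact norm_centeredCharLp_le μ ρ x)
    have h0 := congrArg Complex.re (integral_inner_centeredCharLp μ ρ h)
    rw [Complex.zero_re] at h0
    rw [← h0]
    exact integral_re hi
  · intro h
    rw [hν, integral_map hmeas.aemeasurable
      (f := fun z => (inner ℂ h z).re ^ 2) ((hre h).pow 2).aestronglyMeasurable]
    exact integral_re_inner_sq_le μ ρ hφ hρ h
  · field_simp
    linarith

lemma summable_exp_neg_mul_sqrt {k : ℝ} (hk : 0 < k) :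
    Summable fun n : ℕ => Real.exp (-(k * Real.sqrt n)) := by
  refine Summable.of_nonneg_of_le (fun n => (Real.exp_pos _).le) (fun n => ?_)
    ((Real.summable_one_div_nat_pow.2 (show 1 < 2 by norm_num)).mul_left (24 / k ^ 4) |>.add
      -- At `n = 0` the term `1 / n ^ 2` is `0` by convention while the exponential is `1`.
      (summable_of_ne_finset_zero (s := {0}) (f := fun n : ℕ => if n = 0 then (1 : ℝ) else 0)
        fun n hn => by simpa using hn))
  rcases Nat.eq_zero_or_pos n with rfl | hn
  · simp
  · have hn' : (0 : ℝ) < n := by exact_mod_cast hn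
    have h := Real.pow_div_factorial_le_exp (k * Real.sqrt n) (by positivity) 4
    have h4 : (k * Real.sqrt n) ^ 4 = k ^ 4 * n ^ 2 := by
      have := Real.sq_sqrt hn'.le
      calc (k * Real.sqrt n) ^ 4 = k ^ 4 * (Real.sqrt n ^ 2) ^ 2 := by ring
        _ = _ := by rw [this]
    rw [h4] at h
    rw [Real.exp_neg, if_neg hn.ne', add_zero]
    have h5 : (Nat.factorial 4 : ℝ) = 24 := by norm_num [Nat.factorial]
    rw [h5] at h
    calc (Real.exp (k * Real.sqrt n))⁻¹ ≤ (k ^ 4 * n ^ 2 / 24)⁻¹ := by gcongr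
      _ = 24 / k ^ 4 * (1 / (n : ℝ) ^ 2) := by field_simp

/-- Borel-Cantelli for each `ε`, with `W = δ √n` as volume bound, then a countable sequence of `ε`.
-/
lemma ae_tendsto_integral_norm_ecf_sub (hX_meas : ∀ j, Measurable (X j))
    (hX_indep : iIndepFun X P) (hX_law : ∀ j, P.map (X j) = μ)
    (hφ : Integrable (charFun μ) volume) (D : ℕ → Set Plane)
    (hD_vol : Tendsto (fun n : ℕ => volume (D n) / ENNReal.ofReal (Real.sqrt n)) atTop (𝓝 0)) :
    ∀ᵐ ω ∂P, Tendsto (fun n => ∫ t in D n, ‖ecf (fun j => X j ω) n t - charFun μ t‖)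
      atTop (𝓝 0) := by
  have hsmall : ∀ δ : ℝ, 0 < δ → ∀ᶠ n : ℕ in atTop,
      volume (D n) ≤ ENNReal.ofReal (δ * Real.sqrt n) := fun δ hδ => by
    filter_upwards [hD_vol.eventually_le_const (ENNReal.ofReal_pos.2 hδ),
      eventually_gt_atTop 0] with n hn hn0
    rw [ENNReal.ofReal_mul hδ.le]
    have : (0 : ℝ) < Real.sqrt n := Real.sqrt_pos.2 (by exact_mod_cast hn0)
    rwa [ENNReal.div_le_iff (by simpa using hn0) ENNReal.ofReal_ne_top] at hn
  have hsq : Tendsto (fun n : ℕ => Real.sqrt n) atTop atTop :=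
    Real.tendsto_sqrt_atTop.comp tendsto_natCast_atTop_atTop
  have main : ∀ ε : ℝ, 0 < ε → ∀ᵐ ω ∂P, ∀ᶠ n in atTop,
      ∫ t in D n, ‖ecf (fun j => X j ω) n t - charFun μ t‖ < ε := by
    intro ε hε
    set v := ∫ t, ‖charFun μ t‖ with hv
    have hv0 : 0 ≤ v := integral_nonneg fun t => norm_nonneg _
    obtain ⟨c, hc, hc2, hcv⟩ : ∃ c : ℝ, 0 < c ∧ c ≤ 1 / 2 ∧ c * v ≤ ε / 4 := by
      refine ⟨min (1 / 2) (ε / (4 * (v + 1))), by positivity, min_le_left _ _, ?_⟩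
      calc min (1 / 2) (ε / (4 * (v + 1))) * v ≤ ε / (4 * (v + 1)) * (v + 1) := by
            gcongr
            · exact min_le_right _ _
            · linarith
        _ = ε / 4 := by field_simp
    -- For `W = δ √n`, these give `W ≤ √n` and `32 W² ≤ ε² n`; the choice `ε / 6` works because `32
    -- < 36`.
    obtain ⟨δ, hδ, hδ1, hδε⟩ : ∃ δ : ℝ, 0 < δ ∧ δ ≤ 1 ∧ 32 * δ ^ 2 ≤ ε ^ 2 := by
      refine ⟨min 1 (ε / 6), by positivity, min_le_left _ _, ?_⟩
      have h1 : min 1 (ε / 6) ≤ ε / 6 := min_le_right _ _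
      have h0 : 0 < min 1 (ε / 6) := by positivity
      nlinarith
    have hev : ∀ᶠ n : ℕ in atTop,
        P {ω | ε ≤ ∫ t in D n, ‖ecf (fun j => X j ω) n t - charFun μ t‖} ≤
          ENNReal.ofReal (Real.exp (-(c * ε / 4 * Real.sqrt n))) := by
      filter_upwards [hsmall δ hδ, hsq.eventually_ge_atTop (1 / δ)] with n hn hn1
      have hfin : volume (D n) < ∞ := hn.trans_lt ENNReal.ofReal_lt_top
      have : IsFiniteMeasure (volume.restrict (D n)) := ⟨by simpa using hfin⟩
      have hW1 : 1 ≤ δ * Real.sqrt n := by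
        rw [div_le_iff₀ hδ] at hn1; linarith
      refine measure_integral_norm_ecf_sub_ge_le μ _ hX_meas hX_indep hX_law hφ
        Measure.restrict_le_self hW1 ?_ hε ?_ ?_ hc hc2 hcv
      · rw [measureReal_restrict_apply_univ]
        exact ENNReal.toReal_le_of_le_ofReal (by positivity) hn
      · rw [mul_pow, Real.sq_sqrt (Nat.cast_nonneg n), ← mul_assoc]
        gcongr
      · nlinarith [Real.sqrt_nonneg n]
    obtain ⟨n₀, hn₀⟩ := eventually_atTop.1 hev
    have hsum : ∑' n, P {ω | ε ≤ ∫ t in D (n + n₀),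
        ‖ecf (fun j => X j ω) (n + n₀) t - charFun μ t‖} ≠ ∞ := by
      refine ne_top_of_le_ne_top ?_ (ENNReal.tsum_le_tsum fun n => hn₀ (n + n₀) (by omega))
      exact ((summable_nat_add_iff n₀).2 (summable_exp_neg_mul_sqrt
        (show 0 < c * ε / 4 by positivity))).tsum_ofReal_ne_top
    filter_upwards [ae_eventually_notMem hsum] with ω hω
    obtain ⟨m, hm⟩ := eventually_atTop.1 hω
    filter_upwards [eventually_ge_atTop (m + n₀)] with n hn
    have := hm (n - n₀) (by omega)
    rw [Nat.sub_add_cancel (by omega)] at this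
    exact not_le.1 this
  have hall : ∀ᵐ ω ∂P, ∀ k : ℕ, ∀ᶠ n in atTop,
      ∫ t in D n, ‖ecf (fun j => X j ω) n t - charFun μ t‖ < 1 / ((k : ℝ) + 1) :=
    ae_all_iff.2 fun k => main _ (by positivity)
  filter_upwards [hall] with ω hω
  rw [Metric.tendsto_atTop]
  intro ε hε
  obtain ⟨k, hk⟩ := exists_nat_one_div_lt hε
  obtain ⟨N, hN⟩ := eventually_atTop.1 (hω k)
  refine ⟨N, fun n hn => ?_⟩
  rw [Real.dist_eq, sub_zero, abs_of_nonneg (integral_nonneg fun t => norm_nonneg _)]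
  exact (hN n hn).trans hk

end EmpiricalCharacteristicFunction

/-! ### Deterministic error bound for the estimator and uniform convergence -/

section SelfConsistentEstimator

lemma norm_ecf_le_one (X : ℕ → Plane) (n : ℕ) (t : Plane) : ‖ecf X n t‖ ≤ 1 := by
  rw [ecf, norm_mul, norm_inv, Complex.norm_natCast]
  have h : ‖∑ j ∈ Finset.range n, Complex.exp (Complex.I * (⟪t, X j⟫ : ℝ))‖ ≤ n := by
    refine (norm_sum_le _ _).trans ?_
    simp only [norm_exp_I_mul_ofReal_eq_one]
    simp
  rw [inv_mul_eq_div]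
  exact div_le_one_of_le₀ h (Nat.cast_nonneg n)

lemma continuous_ecf (X : ℕ → Plane) (n : ℕ) : Continuous (ecf X n) := by
  unfold ecf
  fun_prop

lemma one_sub_sqrt_one_sub_le_sqrt {y : ℝ} (hy : 0 ≤ y) :
    1 - Real.sqrt (1 - y) ≤ Real.sqrt y := by
  have hs := Real.sqrt_nonneg y
  have hy2 := Real.sq_sqrt hy
  rcases le_total (Real.sqrt y) 1 with h | h
  · have : 1 - Real.sqrt y ≤ Real.sqrt (1 - y) := Real.le_sqrt_of_sq_le (by nlinarith)
    linarith
  · linarith [Real.sqrt_nonneg (1 - y)]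

/-- Here `m = n - 1` and `z = |ecf|`. The defect `1 - √(1 - y)` is at most `√y = 2 √m / ((m + 1)
z)`, also when `y > 1` and the root is read as `0`. Multiplication by `z` cancels the singularity,
so no lower bound on `|ecf|` is needed. -/
lemma abs_optimal_factor_sub_one_mul_le {m z : ℝ} (hm : 0 < m) (hz : 0 ≤ z) (hz1 : z ≤ 1) :
    |(m + 1) / (2 * m) * (1 + Real.sqrt (1 - 4 * m / ((m + 1) * z) ^ 2)) - 1| * z ≤
      1 / m + 1 / Real.sqrt m := by
  rcases hz.eq_or_lt with rfl | hzpos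
  · rw [mul_zero]; positivity
  set y := 4 * m / ((m + 1) * z) ^ 2 with hy
  have hy0 : 0 ≤ y := by positivity
  have hsm : 0 < Real.sqrt m := Real.sqrt_pos.2 hm
  have hsm2 : Real.sqrt m ^ 2 = m := Real.sq_sqrt hm.le
  have hsy : Real.sqrt y = 2 * Real.sqrt m / ((m + 1) * z) := by
    rw [hy, ← Real.sqrt_sq (show 0 ≤ 2 * Real.sqrt m / ((m + 1) * z) by positivity)]
    congr 1
    rw [div_pow, mul_pow 2 (Real.sqrt m), hsm2]; norm_num
  have h1 := one_sub_sqrt_one_sub_le_sqrt hy0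
  have h2 : Real.sqrt (1 - y) ≤ 1 := Real.sqrt_le_one.2 (by linarith)
  set s := Real.sqrt (1 - y)
  have e : (m + 1) / (2 * m) * (1 + s) - 1 = 1 / m - (m + 1) / (2 * m) * (1 - s) := by
    field_simp; ring
  have hq : (m + 1) / (2 * m) * (1 - s) * z ≤ 1 / Real.sqrt m := by
    calc (m + 1) / (2 * m) * (1 - s) * z
        ≤ (m + 1) / (2 * m) * (2 * Real.sqrt m / ((m + 1) * z)) * z := by
          gcongr; exact h1.trans_eq hsy
      _ = Real.sqrt m / m := by field_simp
      _ = 1 / Real.sqrt m := by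
          rw [div_eq_div_iff hm.ne' hsm.ne']; nlinarith
  have hq0 : 0 ≤ (m + 1) / (2 * m) * (1 - s) :=
    mul_nonneg (by positivity) (by linarith)
  have hzm : 1 / m * z ≤ 1 / m := mul_le_of_le_one_right (by positivity) hz1
  rw [e]
  calc |1 / m - (m + 1) / (2 * m) * (1 - s)| * z
      ≤ (1 / m + (m + 1) / (2 * m) * (1 - s)) * z := by
        gcongr
        refine (abs_sub _ _).trans_eq ?_
        rw [abs_of_nonneg hq0, abs_of_nonneg (by positivity)]
    _ ≤ _ := by linarith

lemma sceTransformKernel_of_mem {X : ℕ → Plane} {A : Set Plane} {n : ℕ} {t : Plane} (h : t ∈ A) :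
    sceTransformKernel X A n t = (n : ℝ) / (2 * ((n : ℝ) - 1)) *
      (1 + Real.sqrt (1 - 4 * ((n : ℝ) - 1) / ‖(n : ℂ) * ecf X n t‖ ^ 2)) := if_pos h

lemma sceTransformKernel_of_notMem {X : ℕ → Plane} {A : Set Plane} {n : ℕ} {t : Plane}
    (h : t ∉ A) : sceTransformKernel X A n t = 0 := if_neg h

lemma norm_sceTransformKernel_mul_ecf_sub_le {X : ℕ → Plane} {A : Set Plane} {n : ℕ} (hn : 2 ≤ n)
    {t : Plane} (h : t ∈ A) :
    ‖(sceTransformKernel X A n t : ℂ) * ecf X n t - ecf X n t‖ ≤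
      1 / ((n : ℝ) - 1) + 1 / Real.sqrt ((n : ℝ) - 1) := by
  have hn' : (2 : ℝ) ≤ n := by exact_mod_cast hn
  have key := abs_optimal_factor_sub_one_mul_le (m := (n : ℝ) - 1) (z := ‖ecf X n t‖)
    (by linarith) (norm_nonneg _) (norm_ecf_le_one X n t)
  rw [sub_add_cancel] at key
  have e : (sceTransformKernel X A n t : ℂ) * ecf X n t - ecf X n t =
      ((sceTransformKernel X A n t - 1 : ℝ) : ℂ) * ecf X n t := by push_cast; ring
  rw [e, norm_mul, Complex.norm_real, Real.norm_eq_abs, sceTransformKernel_of_mem h, norm_mul,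
    Complex.norm_natCast]
  exact key

lemma measurable_sceTransformKernel (X : ℕ → Plane) {A : Set Plane} (hA : MeasurableSet A)
    (n : ℕ) : Measurable (sceTransformKernel X A n) := by
  have hc := (continuous_ecf X n).measurable
  unfold sceTransformKernel
  exact Measurable.ite hA (by fun_prop) measurable_const

lemma abs_sceTransformKernel_le (X : ℕ → Plane) (A : Set Plane) {n : ℕ} (hn : 2 ≤ n) (t : Plane) :
    |sceTransformKernel X A n t| ≤ A.indicator (fun _ => (n : ℝ) / ((n : ℝ) - 1)) t := by
  have hn' : (2 : ℝ) ≤ n := by exact_mod_cast hn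
  by_cases h : t ∈ A
  · have hpos : 0 < (n : ℝ) - 1 := by linarith
    rw [sceTransformKernel_of_mem h, Set.indicator_of_mem h, abs_of_nonneg (by positivity)]
    have : Real.sqrt (1 - 4 * ((n : ℝ) - 1) / ‖(n : ℂ) * ecf X n t‖ ^ 2) ≤ 1 :=
      Real.sqrt_le_one.2 (by
        have : 0 ≤ 4 * ((n : ℝ) - 1) / ‖(n : ℂ) * ecf X n t‖ ^ 2 := by positivity
        linarith)
    calc _ ≤ (n : ℝ) / (2 * ((n : ℝ) - 1)) * (1 + 1) := by gcongr
      _ = _ := by field_simp; norm_num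
  · rw [sceTransformKernel_of_notMem h, Set.indicator_of_notMem h, abs_zero]

lemma integrable_sceTransformKernel (X : ℕ → Plane) {A : Set Plane} (hA : MeasurableSet A)
    (hvol : volume A ≠ ∞) {n : ℕ} (hn : 2 ≤ n) :
    Integrable (fun t => (sceTransformKernel X A n t : ℂ)) := by
  refine Integrable.ofReal (Integrable.mono'
    (g := A.indicator (fun _ => (n : ℝ) / ((n : ℝ) - 1))) ?_
    (measurable_sceTransformKernel X hA n).aestronglyMeasurable
    (Eventually.of_forall fun t => abs_sceTransformKernel_le X A hn t))
  exact (integrable_indicator_iff hA).2 (integrableOn_const hvol)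

lemma norm_exp_neg_I_mul_ofReal_eq_one (a : ℝ) : ‖Complex.exp (-Complex.I * (a : ℂ))‖ = 1 := by
  have := norm_exp_I_mul_ofReal_eq_one (-a)
  rwa [Complex.ofReal_neg, mul_neg, ← neg_mul] at this

/-- Convolution with the empirical measure becomes multiplication by `ecf`; finite volume of `A`
justifies exchanging sum and integral. -/
lemma sce_eq_integral (X : ℕ → Plane) {A : Set Plane} (hA : MeasurableSet A)
    (hvol : volume A ≠ ∞) {n : ℕ} (hn : 2 ≤ n) (x : Plane) :
    sce X A n x = ((2 * Real.pi : ℝ) : ℂ)⁻¹ ^ 2 *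
      ∫ t : Plane, Complex.exp (-Complex.I * (⟪t, x⟫ : ℝ)) *
        ((sceTransformKernel X A n t : ℂ) * ecf X n t) := by
  have hint : ∀ y : Plane, Integrable (fun t : Plane =>
      Complex.exp (-Complex.I * (⟪t, y⟫ : ℝ)) * (sceTransformKernel X A n t : ℂ)) := fun y =>
    Integrable.bdd_mul (c := 1) (integrable_sceTransformKernel X hA hvol hn)
      (Continuous.aestronglyMeasurable (by fun_prop))
      (Eventually.of_forall fun t => (norm_exp_neg_I_mul_ofReal_eq_one _).le)
  simp only [sce, sceKernel]
  rw [← Finset.mul_sum, ← integral_finsetSum _ fun j _ => hint _, mul_left_comm,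
    ← integral_const_mul]
  congr 1
  refine integral_congr_ae (Eventually.of_forall fun t => ?_)
  simp only [ecf, Finset.mul_sum]
  refine Finset.sum_congr rfl fun j _ => ?_
  have : Complex.exp (-Complex.I * (⟪t, x - X j⟫ : ℝ)) =
      Complex.exp (-Complex.I * (⟪t, x⟫ : ℝ)) * Complex.exp (Complex.I * (⟪t, X j⟫ : ℝ)) := by
    rw [← Complex.exp_add, inner_sub_right]; congr 1; push_cast; ring
  rw [this]; ring

/-- On `A`, insert `ecf` between `κ · ecf` and `φ`; off `A` only `φ` is left. Enlarging `A` to `D`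
in the first two terms removes the data-dependent domain from the stochastic one. -/
lemma norm_sce_sub_fourierInversion_le {f : Plane → ℝ} (hφ : Integrable (densityFourier f))
    (X : ℕ → Plane) {A D : Set Plane} (hA : MeasurableSet A) (hD : MeasurableSet D)
    (hAD : A ⊆ D) (hvol : volume D ≠ ∞) {n : ℕ} (hn : 2 ≤ n) (x : Plane) :
    ‖sce X A n x - fourierInversion f x‖ ≤ ‖((2 * Real.pi : ℝ) : ℂ)⁻¹ ^ 2‖ *
      ((∫ t in D, ‖ecf X n t - densityFourier f t‖) +
        volume.real D * (1 / ((n : ℝ) - 1) + 1 / Real.sqrt ((n : ℝ) - 1)) +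
        ∫ t in Aᶜ, ‖densityFourier f t‖) := by
  have hn' : (2 : ℝ) ≤ n := by exact_mod_cast hn
  set b := 1 / ((n : ℝ) - 1) + 1 / Real.sqrt ((n : ℝ) - 1) with hb
  have hb0 : 0 ≤ b := by
    have : 0 < (n : ℝ) - 1 := by linarith
    positivity
  have hvolA : volume A ≠ ∞ := ne_top_of_le_ne_top hvol (measure_mono hAD)
  have hκ := integrable_sceTransformKernel X hA hvolA hn
  have hκC : Integrable fun t => (sceTransformKernel X A n t : ℂ) * ecf X n t :=
    Integrable.mul_bdd (c := 1) hκ (continuous_ecf X n).aestronglyMeasurable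
      (Eventually.of_forall fun t => norm_ecf_le_one X n t)
  have hexp : ∀ {g : Plane → ℂ}, Integrable g → Integrable fun t : Plane =>
      Complex.exp (-Complex.I * (⟪t, x⟫ : ℝ)) * g t := fun hg =>
    Integrable.bdd_mul (c := 1) hg (Continuous.aestronglyMeasurable (by fun_prop))
      (Eventually.of_forall fun t => (norm_exp_neg_I_mul_ofReal_eq_one _).le)
  rw [sce_eq_integral X hA hvolA hn, fourierInversion, ← mul_sub, norm_mul,
    ← integral_sub (hexp hκC) (hexp hφ)]
  gcongr
  have i1 : Integrable (D.indicator fun t => ‖ecf X n t - densityFourier f t‖) := by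
    refine (integrable_indicator_iff hD).2 (Integrable.norm (Integrable.sub ?_ hφ.integrableOn))
    exact Measure.integrableOn_of_bounded hvol (continuous_ecf X n).aestronglyMeasurable
      (M := 1) (Eventually.of_forall fun t => norm_ecf_le_one X n t)
  have i2 : Integrable (D.indicator fun _ : Plane => b) :=
    (integrable_indicator_iff hD).2 (integrableOn_const hvol)
  have i3 : Integrable (Aᶜ.indicator fun t => ‖densityFourier f t‖) := hφ.norm.indicator hA.compl
  calc _ ≤ ∫ t, (D.indicator (fun t => ‖ecf X n t - densityFourier f t‖) t +
        D.indicator (fun _ => b) t + Aᶜ.indicator (fun t => ‖densityFourier f t‖) t) := by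
        refine norm_integral_le_of_norm_le ((i1.add i2).add i3) (Eventually.of_forall fun t => ?_)
        rw [← mul_sub, norm_mul, norm_exp_neg_I_mul_ofReal_eq_one, one_mul]
        by_cases h : t ∈ A
        · simp only [Set.indicator_of_mem (hAD h), Set.indicator_of_notMem (Set.notMem_compl_iff.2 h),
            add_zero]
          have h1 := norm_sceTransformKernel_mul_ecf_sub_le (X := X) hn h
          have h2 := norm_sub_le_norm_sub_add_norm_sub
            ((sceTransformKernel X A n t : ℂ) * ecf X n t) (ecf X n t) (densityFourier f t)
          linarith
        · rw [sceTransformKernel_of_notMem h, Set.indicator_of_mem (Set.mem_compl h)]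
          have h1 : 0 ≤ D.indicator (fun t => ‖ecf X n t - densityFourier f t‖) t :=
            Set.indicator_nonneg (fun _ _ => norm_nonneg _) t
          have h2 : 0 ≤ D.indicator (fun _ => b) t := Set.indicator_nonneg (fun _ _ => hb0) t
          simp only [Complex.ofReal_zero, zero_mul, zero_sub, norm_neg]
          linarith
    _ = _ := by
        rw [integral_add (f := fun t => D.indicator (fun t => ‖ecf X n t - densityFourier f t‖) t +
            D.indicator (fun _ => b) t) (i1.add i2) i3, integral_add i1 i2,
          integral_indicator hD, integral_indicator hD, integral_indicator hA.compl]
        simp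

/-- Integrability handles the outside of a large ball; inside it, `|φ| ≤ 1` bounds the integral by
the volume missed by `A n`. -/
lemma tendsto_setIntegral_compl_norm {φ : Plane → ℂ} (hφ : Integrable φ)
    (hb : ∀ t, ‖φ t‖ ≤ 1) {A : ℕ → Set Plane}
    (hA_compl : ∀ R : ℝ, Tendsto (fun n => volume ((A n)ᶜ ∩ Metric.ball 0 R)) atTop (𝓝 0)) :
    Tendsto (fun n => ∫ t in (A n)ᶜ, ‖φ t‖) atTop (𝓝 0) := by
  have htail : Tendsto (fun k : ℕ => ∫ t in (Metric.ball (0 : Plane) k)ᶜ, ‖φ t‖) atTop (𝓝 0) := by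
    have h := tendsto_setIntegral_of_antitone (μ := (volume : Measure Plane))
      (f := fun t => ‖φ t‖) (s := fun k : ℕ => (Metric.ball (0 : Plane) k)ᶜ)
      (fun k => measurableSet_ball.compl)
      (fun i j hij => Set.compl_subset_compl.2 (Metric.ball_subset_ball (by exact_mod_cast hij)))
      ⟨0, hφ.norm.integrableOn⟩
    have hempty : ⋂ k : ℕ, (Metric.ball (0 : Plane) k)ᶜ = ∅ := by
      rw [← Set.compl_iUnion, Metric.iUnion_ball_nat, Set.compl_univ]
    rwa [hempty, setIntegral_empty] at h
  rw [Metric.tendsto_atTop]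
  intro ε hε
  obtain ⟨k, hk⟩ := (htail.eventually_lt_const (half_pos hε)).exists
  have hev := (hA_compl k).eventually_lt_const (ENNReal.ofReal_pos.2 (half_pos hε))
  obtain ⟨N, hN⟩ := eventually_atTop.1 hev
  refine ⟨N, fun n hn => ?_⟩
  rw [Real.dist_eq, sub_zero, abs_of_nonneg (integral_nonneg fun t => norm_nonneg _)]
  have hfin := (hN n hn).trans ENNReal.ofReal_lt_top
  have h1 : ∫ t in (A n)ᶜ ∩ Metric.ball 0 k, ‖φ t‖ < ε / 2 := by
    have h := norm_setIntegral_le_of_norm_le_const (f := fun t => ‖φ t‖) (C := 1) hfin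
      fun t _ => by rw [norm_norm]; exact hb t
    rw [one_mul] at h
    refine ((le_abs_self _).trans h).trans_lt ?_
    exact (ENNReal.lt_ofReal_iff_toReal_lt hfin.ne).1 (hN n hn)
  have h2 : ∫ t in (A n)ᶜ \ Metric.ball 0 k, ‖φ t‖ ≤ ∫ t in (Metric.ball (0 : Plane) k)ᶜ, ‖φ t‖ :=
    setIntegral_mono_set hφ.norm.integrableOn (Eventually.of_forall fun t => norm_nonneg _)
      (LE.le.eventuallyLE fun t ht => ht.2)
  rw [← integral_inter_add_sdiff measurableSet_ball hφ.norm.integrableOn]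
  linarith

/-- For `n ≥ 2`, both `n - 1` and `√(n - 1)` are at least `√n / 2`. -/
lemma tendsto_volume_mul_rate {D : ℕ → Set Plane}
    (hD_vol : Tendsto (fun n : ℕ => volume (D n) / ENNReal.ofReal (Real.sqrt n)) atTop (𝓝 0)) :
    Tendsto (fun n : ℕ => volume.real (D n) *
      (1 / ((n : ℝ) - 1) + 1 / Real.sqrt ((n : ℝ) - 1))) atTop (𝓝 0) := by
  have h1 : Tendsto (fun n : ℕ => 4 * (volume.real (D n) / Real.sqrt n)) atTop (𝓝 0) := by
    have h := (ENNReal.tendsto_toReal ENNReal.zero_ne_top).comp hD_vol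
    rw [ENNReal.toReal_zero] at h
    have h' := h.const_mul 4
    rw [mul_zero] at h'
    refine h'.congr fun n => ?_
    simp only [Function.comp_apply, ENNReal.toReal_div, ENNReal.toReal_ofReal (Real.sqrt_nonneg _)]
    rfl
  refine squeeze_zero' ?_ ?_ h1
  · filter_upwards [eventually_ge_atTop 2] with n hn
    have hn' : (2 : ℝ) ≤ n := by exact_mod_cast hn
    have : 0 < (n : ℝ) - 1 := by linarith
    positivity
  · filter_upwards [eventually_ge_atTop 2] with n hn
    have hn' : (2 : ℝ) ≤ n := by exact_mod_cast hn
    have hpos : 0 < Real.sqrt n := Real.sqrt_pos.2 (by linarith)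
    have hsq : Real.sqrt n ^ 2 = n := Real.sq_sqrt (by linarith)
    have hs : Real.sqrt n / 2 ≤ Real.sqrt ((n : ℝ) - 1) :=
      Real.le_sqrt_of_sq_le (by rw [div_pow, hsq]; linarith)
    have hm : Real.sqrt n / 2 ≤ (n : ℝ) - 1 := by nlinarith [sq_nonneg (Real.sqrt n - 1)]
    have e1 : 1 / ((n : ℝ) - 1) ≤ 1 / (Real.sqrt n / 2) := by gcongr
    have e2 : 1 / Real.sqrt ((n : ℝ) - 1) ≤ 1 / (Real.sqrt n / 2) := by gcongr
    calc volume.real (D n) * (1 / ((n : ℝ) - 1) + 1 / Real.sqrt ((n : ℝ) - 1))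
        ≤ volume.real (D n) * (1 / (Real.sqrt n / 2) + 1 / (Real.sqrt n / 2)) := by gcongr
      _ = 4 * (volume.real (D n) / Real.sqrt n) := by field_simp; ring

/-- Almost surely, the estimator converges uniformly on the plane to the continuous version of the
density. -/
lemma ae_tendstoUniformly_sce {Ω : Type*} [MeasurableSpace Ω] {P : Measure Ω}
    [IsProbabilityMeasure P] {f : Plane → ℝ} (hf_meas : Measurable f) (hf_nonneg : ∀ x, 0 ≤ f x)
    [IsProbabilityMeasure (densityLaw f)]
    {X : ℕ → Ω → Plane} (hX_meas : ∀ j, Measurable (X j)) (hX_indep : iIndepFun X P)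
    (hX_law : ∀ j, P.map (X j) = densityLaw f) (hφ : Integrable (densityFourier f) volume)
    {A : ℕ → Ω → Set Plane} (hA_meas : ∀ n ω, MeasurableSet (A n ω))
    {D : ℕ → Set Plane} (hD_meas : ∀ n, MeasurableSet (D n))
    (hAD : ∀ᵐ ω ∂P, ∀ᶠ n in atTop, A n ω ⊆ D n)
    (hD_vol : Tendsto (fun n : ℕ => volume (D n) / ENNReal.ofReal (Real.sqrt n)) atTop (𝓝 0))
    (hA_compl : ∀ᵐ ω ∂P, ∀ R : ℝ,
      Tendsto (fun n => volume ((A n ω)ᶜ ∩ Metric.ball 0 R)) atTop (𝓝 0)) :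
    ∀ᵐ ω ∂P, TendstoUniformly (fun n x => sce (fun j => X j ω) (A n ω) n x)
      (fourierInversion f) atTop := by
  have hchar : densityFourier f = charFun (densityLaw f) :=
    funext (densityFourier_eq_charFun_densityLaw hf_meas hf_nonneg)
  have hecf := ae_tendsto_integral_norm_ecf_sub (densityLaw f) hX_meas hX_indep hX_law
    (hchar ▸ hφ) D hD_vol
  -- An infinite volume would make the ratio infinite, so finiteness holds eventually.
  have hfin : ∀ᶠ n in atTop, volume (D n) ≠ ∞ := by
    filter_upwards [hD_vol.eventually_lt_const ENNReal.zero_lt_top] with n hn hcon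
    rw [hcon, ENNReal.top_div_of_ne_top ENNReal.ofReal_ne_top] at hn
    exact lt_irrefl _ hn
  filter_upwards [hecf, hAD, hA_compl] with ω h1 h2 h3
  rw [← hchar] at h1
  have h4 := tendsto_setIntegral_compl_norm hφ
    (fun t => by rw [hchar]; exact norm_charFun_le_one t) h3
  have hlim := (((h1.add (tendsto_volume_mul_rate hD_vol)).add h4).const_mul
    ‖((2 * Real.pi : ℝ) : ℂ)⁻¹ ^ 2‖)
  rw [add_zero, add_zero, mul_zero] at hlim
  rw [Metric.tendstoUniformly_iff]
  intro ε hε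
  filter_upwards [hlim.eventually_lt_const hε, h2, hfin, eventually_ge_atTop 2] with
    n hn hsub hvol hn2 x
  rw [dist_comm, dist_eq_norm]
  exact (norm_sce_sub_fourierInversion_le hφ _ (hA_meas n ω) (hD_meas n) hsub hvol hn2 x).trans_lt hn

end SelfConsistentEstimator

theorem theorem1 {Ω : Type*} [MeasurableSpace Ω] (P : Measure Ω) [IsProbabilityMeasure P]
    -- the true density
    (f : Plane → ℝ) (hf_meas : Measurable f) (hf_nonneg : ∀ x, 0 ≤ f x)
    -- the i.i.d. sample
    (X : ℕ → Ω → Plane) (hX_meas : ∀ j, Measurable (X j)) (hX_indep : iIndepFun X P)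
    (hX_law : ∀ j, P.map (X j) = densityLaw f)
    -- assumptions on the density
    (hf_sq : MemLp f 2 volume) (hφ : Integrable (densityFourier f) volume)
    -- acceptable frequencies `A n ω`, inside a non-random window `D n`
    -- (for non-random acceptable frequencies, `D n = A n ω`)
    (A : ℕ → Ω → Set Plane) (hA_meas : ∀ n ω, MeasurableSet (A n ω))
    (D : ℕ → Set Plane) (hD_meas : ∀ n, MeasurableSet (D n))
    (hAD : ∀ᵐ ω ∂P, ∀ᶠ n in atTop, A n ω ⊆ D n)
    (hA_vol : ∀ᵐ ω ∂P, Tendsto (fun n => volume (A n ω)) atTop (𝓝 ∞))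
    (hD_vol : Tendsto (fun n : ℕ => volume (D n) / ENNReal.ofReal (Real.sqrt n)) atTop (𝓝 0))
    (hA_compl : ∀ᵐ ω ∂P, ∀ R : ℝ,
      Tendsto (fun n => volume ((A n ω)ᶜ ∩ Metric.ball 0 R)) atTop (𝓝 0)) :
    (∃ N : Set Plane, volume N = 0 ∧ ∀ᵐ ω ∂P, ∀ x ∉ N,
      Tendsto (fun n => sce (fun j => X j ω) (A n ω) n x) atTop (𝓝 (f x : ℂ))) ∧
    (ContinuousOn f (densitySupport f) →
      ∀ᵐ ω ∂P, TendstoUniformlyOn (fun n x => sce (fun j => X j ω) (A n ω) n x)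
        (fun x => (f x : ℂ)) atTop (densitySupport f)) ∧
    (ContinuousOn f (densitySupport f) → (∀ x ∉ densitySupport f, f x = 0) →
      ∀ᵐ ω ∂P, TendstoUniformly (fun n x => sce (fun j => X j ω) (A n ω) n x)
        (fun x => (f x : ℂ)) atTop) := by
  have hprob : IsProbabilityMeasure (densityLaw f) := by
    rw [← hX_law 0]
    exact Measure.isProbabilityMeasure_map (hX_meas 0).aemeasurable
  have hae := ae_eq_fourierInversion (integrable_of_isProbabilityMeasure hf_meas hf_nonneg) hφ
  have hcont := continuous_fourierInversion hφ
  have huni := ae_tendstoUniformly_sce hf_meas hf_nonneg hX_meas hX_indep hX_law hφ hA_meas hD_meas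
    hAD hD_vol hA_compl
  -- The null set is where `f` differs from its continuous version; it does not depend on the
  -- sample.
  refine ⟨⟨{x | ¬ (f x : ℂ) = fourierInversion f x}, hae, ?_⟩, fun hfc => ?_, fun hfc hf0 => ?_⟩
  · filter_upwards [huni] with ω hω x hx
    rw [not_not.1 hx]
    exact hω.tendsto_at x
  · have heq := eqOn_densitySupport hcont hae hfc
    filter_upwards [huni] with ω hω
    exact hω.tendstoUniformlyOn.congr_right fun x hx => (heq x hx).symm
  · have heq : fourierInversion f = fun x => (f x : ℂ) := by
      funext x
      by_cases hx : x ∈ densitySupport f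
      · exact (eqOn_densitySupport hcont hae hfc x hx).symm
      · rw [eq_zero_off_densitySupport hcont hae hf0 x hx, hf0 x hx, Complex.ofReal_zero]
    filter_upwards [huni] with ω hω
    rwa [heq] at hω
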